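/- Let $\Lambda$ be a partially ordered set such that every principal lower set $\downarrow\!\alpha=\{x\in\Lambda: x\le\alpha\}$ is finite, $\Lambda$ has finitely many minimal elements, and every $\alpha\in\Lambda$ has finitely many upper neighbors (a $\beta>\alpha$ is an upper neighbor of $\alpha$ if there is no $x$ with $\alpha<x<\beta$). Let $L(\Lambda)$ be the (countable) set of finite lower sets of $\Lambda$. For $A\in L(\Lambda)$ let $\max^*(A)$ be the (finite) set of minimal elements of $\Lambda\setminus A$. For rates $\lambda_\alpha\in(0,\infty)$, $\alpha\in\Lambda$, put $$(\mathscr{L}f)(A)=\sum_{\alpha\in\max^*(A)}\lambda_\alpha\bigl(f(A\cup\{\alpha\})-f(A)\bigr).$$ A process $X=(X_t)_{t\ge0}$ with values in $L(\Lambda)\cup\{\dagger\}$, where $\dagger$ is a cemetery point, is called a Markov process with generator $\mathscr{L}$ started at $\emptyset$ if $X_0=\emptyset$ almost surely and the following two conditions hold. (i) Almost surely, its path is right-continuous as long as it is in the discrete set $L(\Lambda)$; it has a left limit in $L(\Lambda)$ at each time $t$ with $X_t\ne\dagger$; and it stays in $\dagger$ once it is there. (The process is killed at its explosion.) (ii)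 There is a sub-stochastic transition function $p_h(A,B)$ on $L(\Lambda)$, that is, $p_h(A,B)\ge 0$, $\sum_B p_h(A,B)\le1$, $p_0(A,B)=\mathbf 1[A=B]$ and $p_{s+h}(A,B)=\sum_C p_s(A,C)\,p_h(C,B)$, with $$\lim_{h\downarrow0}\frac1h\Bigl(\sum_B p_h(A,B)f(B)-f(A)\Bigr)=(\mathscr{L}f)(A)$$ for all bounded $f:L(\Lambda)\to\mathbb{R}$ and all $A\in L(\Lambda)$, such that for all $s,h\ge 0$ and $A,B\in L(\Lambda)$, almost surely on $\{X_s=A\}$, $\mathbb{P}(X_{s+h}=B\mid X_r,\,r\le s)=p_h(A,B)$. The process is non-explosive if $\mathbb{P}(X_t\ne\dagger)=1$ for all $t$. Its passage times are $\tau_A=\inf\{t\ge0: X_t\ne\dagger,\ A\subseteq X_t\}\in[0,\infty]$ for $A\in L(\Lambda)$. A path in $A\in L(\Lambda)$ is a (possibly empty) finite sequence $\pi=(\pi_1,\dots,\pi_n)$ in $A$ such that $\pi_1$ is a minimal element of $\Lambda$ and each $\pi_{i+1}$ is an upper neighbor of $\pi_i$; its length is $\ell(\pi)=n$. Let $\Pi_m(A)$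 be the set of maximal paths in $A$, i.e. those that are not a proper initial segment of another path in $A$. **Proposition.** Let $\{G_\alpha\}_{\alpha\in\Lambda}$ be independent exponential random variables with rates $\{\lambda_\alpha\}_{\alpha\in\Lambda}$, and set $$\chi_A=\max_{\pi\in\Pi_m(A)}\sum_{i=1}^{\ell(\pi)}G_{\pi_i}\quad(A\in L(\Lambda)),\qquad Y_t=\bigcup\{A\in L(\Lambda):\chi_A\le t\}\quad(t\ge0).$$ Then $(Y_t)_{t\ge0}$, sent to $\dagger$ when $Y_t$ is infinite, is a Markov process with generator $\mathscr{L}$ started at $\emptyset$. If $X$ is any Markov process with generator $\mathscr{L}$ started at $\emptyset$ (on any probability space), then $(Y_t)_{t\ge0}$ (so killed) and $(X_t)_{t\ge0}$ have the same law as processes. If moreover $X$ is non-explosive, then almost surely $Y_t\in L(\Lambda)$ for all $t\ge 0$, and the families $(\chi_A)_{A\in L(\Lambda)}$ and $(\tau_A)_{A\in L(\Lambda)}$ have the same joint law. -/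

import Mathlib

open MeasureTheory ProbabilityTheory Filter Topology Set
open scoped NNReal ENNReal

noncomputable section

namespace CrystalGrowth

/-! ### Locally finite posets, finite lower sets and growth elements -/

/-- A poset is locally finite (in the sense used here) if all principal lower sets are finite,
there are finitely many minimal elements, and every element has finitely many upper neighbors. -/
structure IsLocallyFinitePoset (Λ : Type*) [PartialOrder Λ] : Prop where
  finite_Iic : ∀ α : Λ, (Set.Iic α).Finite
  finite_minimal : {α : Λ | IsMin α}.Finite
  finite_upper : ∀ α : Λ, {β : Λ | α ⋖ β}.Finite

/-- `L(Λ)`: the finite lower sets of `Λ`. -/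
def FinLowerSet (Λ : Type*) [PartialOrder Λ] : Type _ :=
  {A : Set Λ // A.Finite ∧ IsLowerSet A}

section Growth

variable {Λ : Type*} [PartialOrder Λ]

/-- The empty lower set. -/
def emptyLower : FinLowerSet Λ := ⟨∅, Set.finite_empty, isLowerSet_empty⟩

/-- `max*(A)`: the minimal elements of the complement of `A`. -/
def growthElements (A : FinLowerSet Λ) : Set Λ := {α | Minimal (fun x => x ∉ A.1) α}

/-- `A ∪ {α}` for a growth element `α` of `A`. -/
def grow (A : FinLowerSet Λ) (α : growthElements A) : FinLowerSet Λ :=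
  ⟨insert α.1 A.1, A.2.1.insert _, by
    rintro x y hyx (rfl | hx)
    · by_cases hy : y ∈ A.1
      · exact Or.inr hy
      · exact Or.inl (le_antisymm hyx (α.2.2 hy hyx))
    · exact Or.inr (A.2.2 hyx hx)⟩

/-- The generator `(𝓛 f)(A) = ∑_{α ∈ max*(A)} λ_α (f(A ∪ {α}) - f(A))`.  The sum is finite when
`Λ` is locally finite, see `finite_growthElements`. -/
def growthGenerator (rate : Λ → ℝ) (f : FinLowerSet Λ → ℝ) (A : FinLowerSet Λ) : ℝ :=
  ∑ᶠ α : growthElements A, rate α.1 * (f (grow A α) - f A)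

theorem finite_growthElements (hΛ : IsLocallyFinitePoset Λ) (A : FinLowerSet Λ) :
    (growthElements A).Finite := by
  refine (hΛ.finite_minimal.union
    (A.2.1.biUnion fun α _ => hΛ.finite_upper α)).subset fun β hβ => ?_
  by_cases hm : IsMin β
  · exact Or.inl hm
  · right
    obtain ⟨γ, hγ⟩ := not_isMin_iff.1 hm
    have hfin : (Set.Iio β).Finite := (hΛ.finite_Iic β).subset Set.Iio_subset_Iic_self
    obtain ⟨δ, hδ⟩ := hfin.exists_maximal ⟨γ, hγ⟩
    have hcov : δ ⋖ β := ⟨hδ.1, fun c hc hcb => absurd (hδ.2 hcb hc.le) hc.not_ge⟩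
    have hδA : δ ∈ A.1 := by
      by_contra h
      exact absurd (hβ.2 h hδ.1.le) (not_le_of_gt hδ.1)
    exact Set.mem_biUnion hδA hcov

/-! ### Last passage percolation -/

/-- `Π(A)`: the (possibly empty) paths `(π₁, …, πₙ)` in `A`, that is, `π₁` is minimal in `Λ`, each
`πᵢ₊₁` is an upper neighbor of `πᵢ`, and all `πᵢ` belong to `A`. -/
def paths (A : FinLowerSet Λ) : Set (List Λ) :=
  {π | (∀ α ∈ π.head?, IsMin α) ∧ π.IsChain (· ⋖ ·) ∧ ∀ α ∈ π, α ∈ A.1}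

/-- `Π_m(A)`: the maximal paths in `A`, those that cannot be extended to a longer path in `A`. -/
def maxPaths (A : FinLowerSet Λ) : Set (List Λ) :=
  {π | π ∈ paths A ∧ ∀ π' ∈ paths A, π <+: π' → π' = π}

/-- The last passage value `χ_A = max_{π ∈ Π_m(A)} ∑ᵢ g_{πᵢ}` of weights `g`.  The supremum is over
a finite nonempty set and hence is a maximum, see `isGreatest_passageValue`. -/
def passageValue (g : Λ → ℝ) (A : FinLowerSet Λ) : ℝ :=
  sSup ((fun π : List Λ => (π.map g).sum) '' maxPaths A)

theorem paths_finite (A : FinLowerSet Λ) : (paths A).Finite := by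
  have hinj : Set.InjOn (fun π : List Λ => {x | x ∈ π}) (paths A) := by
    intro π hπ π' hπ' h
    have h1 : π.Pairwise (· < ·) := (hπ.2.1.imp fun _ _ h => h.lt).pairwise
    have h2 : π'.Pairwise (· < ·) := (hπ'.2.1.imp fun _ _ h => h.lt).pairwise
    have hp : π.Perm π' := (List.perm_ext_iff_of_nodup (h1.imp fun h => h.ne)
      (h2.imp fun h => h.ne)).2 fun a => by
        have := congrArg (fun s : Set Λ => a ∈ s) h
        simpa using this
    exact hp.eq_of_pairwise (fun a b _ _ h h' => absurd h' h.asymm) h1 h2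
  refine Set.Finite.of_finite_image (A.2.1.finite_subsets.subset ?_) hinj
  rintro _ ⟨π, hπ, rfl⟩
  exact fun x hx => hπ.2.2 x hx

theorem isGreatest_passageValue (g : Λ → ℝ) (A : FinLowerSet Λ) :
    IsGreatest ((fun π : List Λ => (π.map g).sum) '' maxPaths A) (passageValue g A) := by
  have hne : (maxPaths A).Nonempty := by
    obtain ⟨π, hπ, hmax⟩ := Set.exists_max_image (paths A) List.length (paths_finite A)
      ⟨[], by simp [paths]⟩
    exact ⟨π, hπ, fun π' hπ' hpre => (hpre.eq_of_length_le (hmax π' hπ')).symm⟩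
  have hfin : (maxPaths A).Finite := (paths_finite A).subset fun π h => h.1
  exact ⟨(hne.image _).csSup_mem (hfin.image _), fun x hx => le_csSup (hfin.image _).bddAbove hx⟩

/-- `Y_t = ⋃ {A ∈ L(Λ) : χ_A ≤ t}`, a lower set of `Λ` that may a priori be infinite. -/
def lppSet (g : Λ → ℝ) (t : ℝ≥0) : Set Λ :=
  ⋃ A ∈ {A : FinLowerSet Λ | passageValue g A ≤ t}, A.1

theorem isLowerSet_lppSet (g : Λ → ℝ) (t : ℝ≥0) : IsLowerSet (lppSet g t) :=
  isLowerSet_iUnion fun A => isLowerSet_iUnion fun _ => A.2.2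

open Classical in
/-- `Y_t` as an element of `L(Λ)` with a cemetery point `none` adjoined: it is `Y_t` as long as
`Y_t` is finite, and the cemetery from the moment when `Y_t` is infinite. -/
def lppState (g : Λ → ℝ) (t : ℝ≥0) : Option (FinLowerSet Λ) :=
  if h : (lppSet g t).Finite then some ⟨lppSet g t, h, isLowerSet_lppSet g t⟩ else none

/-- The passage time `τ_A = inf {t ≥ 0 : A ⊆ x_t}` of a path `x` in `L(Λ)` (with cemetery); it is
`⊤` if there is no such `t`. -/
def passageTime (x : ℝ≥0 → Option (FinLowerSet Λ)) (A : FinLowerSet Λ) : EReal :=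
  sInf {u : EReal | ∃ t : ℝ≥0, u = ((t : ℝ) : EReal) ∧ ∃ B, x t = some B ∧ A.1 ⊆ B.1}

/-- The discrete σ-algebra on `L(Λ)` with the cemetery point. -/
instance : MeasurableSpace (Option (FinLowerSet Λ)) := ⊤

instance : DiscreteMeasurableSpace (Option (FinLowerSet Λ)) :=
  ⟨fun _ => MeasurableSpace.measurableSet_top⟩

end Growth

/-! ### Continuous time Markov processes on a countable state space

`E` is a countable state space; `Option E` adjoins a cemetery point `none`, where the process is
put from its explosion time on. -/

section Markov

variable {E : Type*}

/-- A standard (sub-)stochastic transition function on `E`; the missing mass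
`1 - ∑' b, p t a b` is the probability that the process started from `a` has exploded by time
`t`. -/
structure IsTransitionFunction (p : ℝ≥0 → E → E → ℝ) : Prop where
  nonneg : ∀ t a b, 0 ≤ p t a b
  summable : ∀ t a, Summable (p t a)
  tsum_le_one : ∀ t a, ∑' b, p t a b ≤ 1
  zero_self : ∀ a, p 0 a a = 1
  zero_ne : ∀ a b, a ≠ b → p 0 a b = 0
  chapman_kolmogorov : ∀ s t a b, p (s + t) a b = ∑' c, p s a c * p t c b

/-- The transition function `p` has infinitesimal generator `gen`: for bounded `f`,
`(∑' b, p h a b * f b - f a) / h → (gen f)(a)` as `h ↓ 0`. -/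
def HasGenerator (p : ℝ≥0 → E → E → ℝ) (gen : (E → ℝ) → E → ℝ) : Prop :=
  ∀ f : E → ℝ, (∃ C, ∀ a, |f a| ≤ C) → ∀ a,
    Tendsto (fun h : ℝ≥0 => (∑' b, p h a b * f b - f a) / (h : ℝ)) (𝓝[>] 0) (𝓝 (gen f a))

/-- Regularity of the path of a jump process up to its explosion: it is right-continuous (`E`
being discrete) and has left limits in `E` as long as it is in `E`, and it stays in the cemetery
once it is there.  So if `x t ≠ none` then `x` makes only finitely many jumps, within `E`, on
`[0, t]`. -/
structure IsJumpPath (x : ℝ≥0 → Option E) : Prop where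
  right_cont : ∀ t a, x t = some a → ∀ᶠ u in 𝓝[>] t, x u = some a
  left_lim : ∀ t, x t ≠ none → ∃ a, ∀ᶠ u in 𝓝[<] t, x u = some a
  absorbed : ∀ s t, s ≤ t → x s = none → x t = none

/-- The natural filtration `σ(X_r : r ≤ s)` of a process. -/
abbrev history {Ω : Type*} (X : ℝ≥0 → Ω → Option E) (s : ℝ≥0) : MeasurableSpace Ω :=
  ⨆ r : ℝ≥0, ⨆ _ : r ≤ s, MeasurableSpace.comap (X r) ⊤

/-- `X` is a (possibly explosive, killed at explosion) Markov process on the countable discrete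
state space `E`, started at `x₀`, with infinitesimal generator `gen`: almost all its paths are
jump paths, and there is a transition function `p` with generator `gen` such that
`P(X_{s+h} = b | X_r, r ≤ s) = p_h(X_s, b)`. -/
structure IsMarkovJumpProcess {Ω : Type*} [MeasurableSpace Ω] (μ : Measure Ω)
    (X : ℝ≥0 → Ω → Option E) (x₀ : E) (gen : (E → ℝ) → E → ℝ) : Prop where
  measurable : ∀ t (S : Set (Option E)), MeasurableSet (X t ⁻¹' S)
  initial : ∀ᵐ ω ∂μ, X 0 ω = some x₀
  jumpPath : ∀ᵐ ω ∂μ, IsJumpPath fun t => X t ω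
  markov : ∃ p : ℝ≥0 → E → E → ℝ, IsTransitionFunction p ∧ HasGenerator p gen ∧
    ∀ (s h : ℝ≥0) (F : Set Ω), MeasurableSet[history X s] F → ∀ a b : E,
      μ.real (F ∩ {ω | X s ω = some a} ∩ {ω | X (s + h) ω = some b}) =
        μ.real (F ∩ {ω | X s ω = some a}) * p h a b

end Markov

end CrystalGrowth

end

noncomputable section

namespace CrystalGrowth

/-! ### Posets with finite principal lower sets -/

section Deterministic

variable {Λ : Type*} [PartialOrder Λ]

/-! Let each element `β` start a clock of length `w β` as soon as all smaller elements have been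
added. Its time of addition satisfies `T(β) = w β + sup_{γ < β} T(γ)`, a well-founded recursion
(`growthTime`). Unfolding it along a slowest predecessor shows that `T(β)` is the largest weight of
a path ending at `β`, so `χ_A ≤ t` exactly when all of `A` has been added by time `t`
(`passageValue_le_iff`). Thus `Y_t` is the set `{β | T(β) ≤ t}`.

The Markov property is memorylessness. On the event that the state at time `s` is `A`, the past is a
function of the weights on `A`. The event itself then says only that each growth element's weight
exceeds the time it has already waited, and the future is the growth from `A` with the residual
weights. Fubini over the weights on and off `A`, together with `weightLaw_shift`, gives
`growFrom_markov`. The generator comes from explicit lower bounds for the probabilities of no step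
and of one given step: these have the right derivatives and total mass `1 - o(h)`, so everything
else is `o(h)` (`hasGenerator_transProb`).

For uniqueness, a jump whose probability over time `h` is `o(h)` almost surely never occurs on a
jump path, by a union bound over fine grids (`HasTransition.ae_no_jump`). Hence any process with
this generator grows monotonically. Every state is visited with positive probability at some time,
so its transition function satisfies `p_t(A,B) = 0` unless `A ⊆ B`. Only finitely many states then
lead to `B`, and Chapman–Kolmogorov becomes finite matrix multiplication, in which the derivative at
`0` determines `p` even if the process explodes (`transition_unique`). Equal transition functions
give equal finite-dimensional laws, hence equal laws of the processes.

Passage times of jump paths are a measurable function of the process, since by right-continuity a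
countable dense set of times suffices. Without explosion they equal `χ_A` for `Y`, so the law
transfers. -/

theorem IsLocallyFinitePoset.wellFoundedLT (hΛ : IsLocallyFinitePoset Λ) : WellFoundedLT Λ :=
  StrictMono.wellFoundedLT (f := fun α : Λ => (Set.Iic α).ncard) fun _ β h =>
    Set.ncard_lt_ncard (Set.Iic_ssubset_Iic.2 h) (hΛ.finite_Iic β)

theorem IsLocallyFinitePoset.finite_Iio (hΛ : IsLocallyFinitePoset Λ) (β : Λ) :
    (Set.Iio β).Finite :=
  (hΛ.finite_Iic β).subset Set.Iio_subset_Iic_self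

theorem IsLocallyFinitePoset.exists_le_covBy (hΛ : IsLocallyFinitePoset Λ) {γ β : Λ}
    (h : γ < β) : ∃ δ, γ ≤ δ ∧ δ ⋖ β := by
  obtain ⟨δ, hγδ, hδ⟩ := (hΛ.finite_Iio β).exists_le_maximal h
  exact ⟨δ, hγδ, hδ.1, fun c hc hcb => absurd (hδ.2 hcb hc.le) hc.not_ge⟩

/-- Every element is reached from a minimal one by finitely many covering steps, and each level of
this exploration is finite. -/
theorem IsLocallyFinitePoset.countable (hΛ : IsLocallyFinitePoset Λ) : Countable Λ := by
  have := hΛ.wellFoundedLT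
  let S : ℕ → Set Λ := fun n =>
    Nat.rec {α : Λ | IsMin α} (fun _ T => ⋃ γ ∈ T, {β : Λ | γ ⋖ β}) n
  have hS : ∀ n, (S n).Finite := by
    intro n
    induction n with
    | zero => exact hΛ.finite_minimal
    | succ n ih => exact ih.biUnion fun γ _ => hΛ.finite_upper γ
  have hcov : (⋃ n, S n) = Set.univ := by
    refine Set.eq_univ_of_forall fun β => ?_
    induction β using WellFoundedLT.induction with
    | ind β ih =>
      by_cases hm : IsMin β
      · exact Set.mem_iUnion.2 ⟨0, hm⟩
      · obtain ⟨γ, hγ⟩ := not_isMin_iff.1 hm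
        obtain ⟨δ, -, hδ⟩ := hΛ.exists_le_covBy hγ
        obtain ⟨n, hn⟩ := Set.mem_iUnion.1 (ih δ hδ.lt)
        exact Set.mem_iUnion.2 ⟨n + 1, Set.mem_biUnion hn hδ⟩
  rw [← Set.countable_univ_iff, ← hcov]
  exact Set.countable_iUnion fun n => (hS n).countable

theorem FinLowerSet.ext {A B : FinLowerSet Λ} (h : A.1 = B.1) : A = B := Subtype.ext h

theorem FinLowerSet.countable [Countable Λ] : Countable (FinLowerSet Λ) := by
  refine Function.Injective.countable (f := fun A : FinLowerSet Λ => A.2.1.toFinset) ?_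
  intro A B h
  exact FinLowerSet.ext (by simpa using h)

/-- The principal lower set of `β`. -/
def principalLower (hΛ : IsLocallyFinitePoset Λ) (β : Λ) : FinLowerSet Λ :=
  ⟨Set.Iic β, hΛ.finite_Iic β, isLowerSet_Iic β⟩

theorem mem_of_lt_growthElement {A : FinLowerSet Λ} {α γ : Λ} (hα : α ∈ growthElements A)
    (h : γ < α) : γ ∈ A.1 := by
  by_contra hγ
  exact absurd (hα.2 hγ h.le) h.not_ge

theorem exists_growthElement_le [WellFoundedLT Λ] {A : FinLowerSet Λ} {β : Λ} (hβ : β ∉ A.1) :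
    ∃ α ∈ growthElements A, α ≤ β := by
  obtain ⟨α, h, h'⟩ := exists_minimal_le_of_wellFoundedLT (fun x => x ∉ A.1) β hβ
  exact ⟨α, h', h⟩

theorem sum_map_ofReal {Λ : Type*} {g : Λ → ℝ} (hg : ∀ α, 0 ≤ g α) (l : List Λ) :
    (l.map fun α => ENNReal.ofReal (g α)).sum = ENNReal.ofReal (l.map g).sum := by
  induction l with
  | nil => simp
  | cons a l ih =>
    rw [List.map_cons, List.map_cons, List.sum_cons, List.sum_cons, ih, ENNReal.ofReal_add (hg a)]
    exact List.sum_nonneg (by simpa using fun α _ => hg α)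

theorem passageValue_nonneg {g : Λ → ℝ} (hg : ∀ α, 0 ≤ g α) (A : FinLowerSet Λ) :
    0 ≤ passageValue g A := by
  obtain ⟨π, -, h⟩ := (isGreatest_passageValue g A).1
  rw [← h]
  exact List.sum_nonneg (by simpa using fun α _ => hg α)

theorem lppState_eq_some {g : Λ → ℝ} {t : ℝ≥0} {A : FinLowerSet Λ} :
    lppState g t = some A ↔ lppSet g t = A.1 := by
  unfold lppState
  split_ifs with h
  · exact Option.some_inj.trans Subtype.ext_iff
  · exact ⟨fun h' => h'.elim, fun h' => absurd (h' ▸ A.2.1) h⟩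

theorem lppState_ne_none {g : Λ → ℝ} {t : ℝ≥0} :
    lppState g t ≠ none ↔ (lppSet g t).Finite := by
  unfold lppState
  split_ifs with h <;> simp [h]

/-! ### Growth times of a family of weights -/

/-- The time at which `β` is added when each element waits for a time given by its weight
after all smaller elements have been added. -/
def growthTime [WellFoundedLT Λ] (w : Λ → ℝ≥0∞) (β : Λ) : ℝ≥0∞ :=
  w β + ⨆ γ : Set.Iio β, growthTime w γ.1
termination_by (wellFounded_lt (α := Λ)).wrap β
decreasing_by exact γ.2

variable [WellFoundedLT Λ]

/-- The time at which all elements smaller than `β` have been added. -/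
def readyTime (w : Λ → ℝ≥0∞) (β : Λ) : ℝ≥0∞ := ⨆ γ : Set.Iio β, growthTime w γ.1

theorem growthTime_eq (w : Λ → ℝ≥0∞) (β : Λ) : growthTime w β = w β + readyTime w β := by
  rw [growthTime, readyTime]

theorem growthTime_le_readyTime (w : Λ → ℝ≥0∞) {γ β : Λ} (h : γ < β) :
    growthTime w γ ≤ readyTime w β :=
  le_iSup (fun γ : Set.Iio β => growthTime w γ.1) ⟨γ, h⟩

theorem readyTime_le {w : Λ → ℝ≥0∞} {β : Λ} {t : ℝ≥0∞} (h : ∀ γ < β, growthTime w γ ≤ t) :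
    readyTime w β ≤ t :=
  iSup_le fun γ => h γ.1 γ.2

theorem growthTime_mono (w : Λ → ℝ≥0∞) : Monotone (growthTime w) := by
  intro γ β h
  rcases h.eq_or_lt with rfl | h
  · exact le_rfl
  · rw [growthTime_eq w β]
    exact (growthTime_le_readyTime w h).trans le_add_self

theorem growthTime_congr {w w' : Λ → ℝ≥0∞} (β : Λ) (h : ∀ γ ≤ β, w γ = w' γ) :
    growthTime w β = growthTime w' β := by
  induction β using WellFoundedLT.induction with
  | ind β ih =>
    rw [growthTime_eq, growthTime_eq, h β le_rfl, readyTime, readyTime]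
    congr 1
    exact iSup_congr fun γ => ih γ.1 γ.2 fun δ hδ => h δ (hδ.trans γ.2.le)

theorem readyTime_congr {w w' : Λ → ℝ≥0∞} (β : Λ) (h : ∀ γ < β, w γ = w' γ) :
    readyTime w β = readyTime w' β :=
  iSup_congr fun γ => growthTime_congr γ.1 fun _ hδ => h _ (hδ.trans_lt γ.2)

theorem growthTime_eq_zero {w : Λ → ℝ≥0∞} (β : Λ) (h : ∀ γ ≤ β, w γ = 0) :
    growthTime w β = 0 := by
  induction β using WellFoundedLT.induction with
  | ind β ih =>
    rw [growthTime_eq, h β le_rfl, zero_add, readyTime, ENNReal.iSup_eq_zero]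
    exact fun γ => ih γ.1 γ.2 fun δ hδ => h δ (hδ.trans γ.2.le)

theorem readyTime_eq_zero {w : Λ → ℝ≥0∞} (β : Λ) (h : ∀ γ < β, w γ = 0) :
    readyTime w β = 0 :=
  ENNReal.iSup_eq_zero.2 fun γ => growthTime_eq_zero γ.1 fun _ hδ => h _ (hδ.trans_lt γ.2)

theorem measurable_growthTime [Countable Λ] (β : Λ) :
    Measurable fun w : Λ → ℝ≥0∞ => growthTime w β := by
  induction β using WellFoundedLT.induction with
  | ind β ih =>
    simp_rw [growthTime_eq, readyTime]
    exact (measurable_pi_apply β).add (Measurable.iSup fun γ => ih γ.1 γ.2)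

/-- The set of elements that have been added by time `t`. -/
def grownSet (w : Λ → ℝ≥0∞) (t : ℝ≥0) : Set Λ := {β | growthTime w β ≤ t}

theorem mem_grownSet {w : Λ → ℝ≥0∞} {t : ℝ≥0} {β : Λ} :
    β ∈ grownSet w t ↔ growthTime w β ≤ t := Iff.rfl

theorem isLowerSet_grownSet (w : Λ → ℝ≥0∞) (t : ℝ≥0) : IsLowerSet (grownSet w t) :=
  fun _ _ h hβ => (growthTime_mono w h).trans hβ

theorem grownSet_mono (w : Λ → ℝ≥0∞) : Monotone (grownSet w) :=
  fun _ _ h _ hβ => mem_grownSet.2 ((mem_grownSet.1 hβ).trans (ENNReal.coe_le_coe.2 h))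

theorem grownSet_eq_iff {w : Λ → ℝ≥0∞} {t : ℝ≥0} {A : FinLowerSet Λ} :
    grownSet w t = A.1 ↔
      (∀ β ∈ A.1, growthTime w β ≤ t) ∧ ∀ α ∈ growthElements A, (t : ℝ≥0∞) < growthTime w α := by
  constructor
  · intro h
    refine ⟨fun β hβ => ?_, fun α hα => ?_⟩
    · rw [← h] at hβ
      exact hβ
    · by_contra! hle
      exact hα.1 (h ▸ (hle : α ∈ grownSet w t))
  · rintro ⟨h1, h2⟩
    refine Set.Subset.antisymm (fun β hβ => ?_) h1
    by_contra hn
    obtain ⟨α, hα, hle⟩ := exists_growthElement_le hn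
    exact absurd ((growthTime_mono w hle).trans hβ) (h2 α hα).not_ge

/-- The growth from a state `A` reached at time `s` on is again a growth process, for the
residual weights. -/
theorem growthTime_sup_eq {w w' : Λ → ℝ≥0∞} {s : ℝ≥0} {A : FinLowerSet Λ}
    (hA : grownSet w s = A.1) (h0 : ∀ β ∈ A.1, w' β = 0)
    (h1 : ∀ β ∈ growthElements A, w' β = w β - (s - readyTime w β))
    (h2 : ∀ β, β ∉ A.1 → β ∉ growthElements A → w' β = w β) (β : Λ) :
    growthTime w β ⊔ s = s + growthTime w' β := by
  obtain ⟨hle, hlt⟩ := grownSet_eq_iff.1 hA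
  induction β using WellFoundedLT.induction with
  | ind β ih =>
    by_cases hβ : β ∈ A.1
    · rw [sup_eq_right.2 (hle β hβ), growthTime_eq_zero β fun γ hγ => h0 γ (A.2.2 hγ hβ), add_zero]
    have hs : (s : ℝ≥0∞) < growthTime w β := by
      by_contra! h
      exact hβ (hA ▸ (h : β ∈ grownSet w s))
    rw [sup_eq_left.2 hs.le]
    by_cases hg : β ∈ growthElements A
    · have hr : readyTime w β ≤ s :=
        readyTime_le fun γ hγ => hle γ (mem_of_lt_growthElement hg hγ)
      rw [growthTime_eq w', readyTime_eq_zero (w := w') β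
        fun γ hγ => h0 γ (mem_of_lt_growthElement hg hγ), add_zero, h1 β hg]
      rw [growthTime_eq] at hs ⊢
      have hsub : (s : ℝ≥0∞) - readyTime w β ≤ w β := tsub_le_iff_right.2 hs.le
      calc w β + readyTime w β
          = (w β - (s - readyTime w β)) + ((s - readyTime w β) + readyTime w β) := by
            rw [← add_assoc, tsub_add_cancel_of_le hsub]
        _ = _ := by rw [tsub_add_cancel_of_le hr, add_comm]
    · obtain ⟨α, hα, hαβ⟩ := exists_growthElement_le hβ
      have hαβ : α < β := lt_of_le_of_ne hαβ fun h => hg (h ▸ hα)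
      have : Nonempty (Set.Iio β) := ⟨⟨α, hαβ⟩⟩
      -- The growth element `α < β` is added after time `s`, so raising all times below `β` to at
      -- least `s` does not change their supremum.
      have hsup : readyTime w β = s + readyTime w' β := by
        rw [readyTime, readyTime, ENNReal.add_iSup]
        have hs' : (s : ℝ≥0∞) ≤ ⨆ γ : Set.Iio β, growthTime w γ.1 :=
          (hlt α hα).le.trans (growthTime_le_readyTime w hαβ)
        calc _ = ⨆ γ : Set.Iio β, growthTime w γ.1 ⊔ s := by
              rw [← iSup_sup, sup_eq_left.2 hs']
          _ = _ := iSup_congr fun γ => ih γ.1 γ.2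
      rw [growthTime_eq, growthTime_eq w', h2 β hβ hg, hsup, add_left_comm]

theorem grownSet_add_eq {w w' : Λ → ℝ≥0∞} {s : ℝ≥0} {A : FinLowerSet Λ}
    (hA : grownSet w s = A.1) (h0 : ∀ β ∈ A.1, w' β = 0)
    (h1 : ∀ β ∈ growthElements A, w' β = w β - (s - readyTime w β))
    (h2 : ∀ β, β ∉ A.1 → β ∉ growthElements A → w' β = w β) (h : ℝ≥0) :
    grownSet w (s + h) = grownSet w' h := by
  ext β
  have key := growthTime_sup_eq hA h0 h1 h2 β
  rw [mem_grownSet, mem_grownSet]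
  rw [← ENNReal.add_le_add_iff_left (ENNReal.coe_ne_top (r := s)) (c := (h : ℝ≥0∞)), ← key]
  simp

open Classical in
/-- The grown set as an element of `L(Λ)` with a cemetery point. -/
def growthState (w : Λ → ℝ≥0∞) (t : ℝ≥0) : Option (FinLowerSet Λ) :=
  if h : (grownSet w t).Finite then some ⟨grownSet w t, h, isLowerSet_grownSet w t⟩ else none

theorem growthState_eq_some {w : Λ → ℝ≥0∞} {t : ℝ≥0} {A : FinLowerSet Λ} :
    growthState w t = some A ↔ grownSet w t = A.1 := by
  unfold growthState
  split_ifs with h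
  · exact Option.some_inj.trans Subtype.ext_iff
  · exact ⟨fun h' => h'.elim, fun h' => absurd (h' ▸ A.2.1) h⟩

theorem growthState_ne_none {w : Λ → ℝ≥0∞} {t : ℝ≥0} :
    growthState w t ≠ none ↔ (grownSet w t).Finite := by
  unfold growthState
  split_ifs with h <;> simp [h]

/-- A state `A` persists until the first of its finitely many growth elements is added, which gives
right-continuity. The left limit at `t` consists of the elements added strictly before `t`, a finite
set because the state at `t` is finite. -/
theorem isJumpPath_growthState (hΛ : IsLocallyFinitePoset Λ) (w : Λ → ℝ≥0∞) :
    IsJumpPath (growthState w) where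
  right_cont t A hA := by
    rw [growthState_eq_some] at hA
    obtain ⟨-, hlt⟩ := grownSet_eq_iff.1 hA
    have hev : ∀ᶠ u : ℝ≥0 in 𝓝 t, ∀ α ∈ growthElements A, (u : ℝ≥0∞) < growthTime w α := by
      rw [Filter.eventually_all_finite (finite_growthElements hΛ A)]
      exact fun α hα => ENNReal.continuous_coe.continuousAt.eventually_lt_const (hlt α hα)
    filter_upwards [nhdsWithin_le_nhds hev, self_mem_nhdsWithin] with u hu htu
    rw [growthState_eq_some, grownSet_eq_iff]
    exact ⟨fun β hβ => grownSet_mono w (le_of_lt htu) (hA ▸ hβ : β ∈ grownSet w t), hu⟩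
  left_lim t ht := by
    rw [growthState_ne_none] at ht
    have hlow : IsLowerSet {β | growthTime w β < t} :=
      fun _ _ h hβ => (growthTime_mono w h).trans_lt hβ
    have hfin : {β | growthTime w β < t}.Finite :=
      ht.subset fun β (hβ : growthTime w β < t) => hβ.le
    refine ⟨⟨{β | growthTime w β < t}, hfin, hlow⟩, ?_⟩
    have hev : ∀ᶠ u : ℝ≥0 in 𝓝 t, ∀ β ∈ {β | growthTime w β < t},
        growthTime w β < (u : ℝ≥0∞) := by
      rw [Filter.eventually_all_finite hfin]
      exact fun β hβ => ENNReal.continuous_coe.continuousAt.eventually_const_lt hβ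
    filter_upwards [nhdsWithin_le_nhds hev, self_mem_nhdsWithin] with u hu hut
    refine growthState_eq_some.2 (Set.ext fun β => ⟨fun h => ?_, fun h => (hu β h).le⟩)
    exact lt_of_le_of_lt (mem_grownSet.1 h) (ENNReal.coe_lt_coe.2 hut)
  absorbed s t hst h := by
    by_contra hne
    exact growthState_ne_none.2
      ((growthState_ne_none.1 hne).subset (grownSet_mono w hst)) h

/-! ### Last passage percolation as growth -/

/-- Each covering step costs at least the weight of the next element. Starting from `growthTime w a`
instead of `w a` lets the induction along the chain close. -/
theorem growthTime_add_sum_le (w : Λ → ℝ≥0∞) (l : List Λ) (a : Λ)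
    (h : (a :: l).IsChain (· ⋖ ·)) :
    growthTime w a + (l.map w).sum ≤ growthTime w ((a :: l).getLast (List.cons_ne_nil a l)) := by
  induction l generalizing a with
  | nil => simp
  | cons b l ih =>
    rw [List.isChain_cons_cons] at h
    rw [List.getLast_cons (List.cons_ne_nil b l), List.map_cons, List.sum_cons, ← add_assoc]
    refine le_trans (add_le_add_left ?_ _) (ih b h.2)
    rw [growthTime_eq w b, add_comm]
    exact add_le_add_right (growthTime_le_readyTime w h.1.lt) _

/-- Go back from `β` to a smaller element that was added last. By monotonicity it can be taken to be
covered by `β`, so the backward walk is a path that realizes the growth time. -/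
theorem exists_path_growthTime (hΛ : IsLocallyFinitePoset Λ) (w : Λ → ℝ≥0∞) (β : Λ) :
    ∃ π : List Λ, (∀ α ∈ π.head?, IsMin α) ∧ π.IsChain (· ⋖ ·) ∧ (∀ α ∈ π, α ≤ β) ∧
      π.getLast? = some β ∧ growthTime w β = (π.map w).sum := by
  induction β using WellFoundedLT.induction with
  | ind β ih =>
    by_cases hm : IsMin β
    · refine ⟨[β], by simpa using hm, by simp, by simp, by simp, ?_⟩
      have : IsEmpty (Set.Iio β) := ⟨fun γ => hm.not_lt γ.2⟩
      rw [growthTime_eq, readyTime]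
      simp
    · obtain ⟨γ₀, hγ₀⟩ := not_isMin_iff.1 hm
      obtain ⟨γ, hγ, hmax⟩ :=
        Set.exists_max_image _ (growthTime w) (hΛ.finite_Iio β) ⟨γ₀, hγ₀⟩
      obtain ⟨δ, hγδ, hδ⟩ := hΛ.exists_le_covBy hγ
      obtain ⟨π, h1, h2, h3, h4, h5⟩ := ih δ hδ.lt
      have hne : π ≠ [] := by rintro rfl; simp at h4
      refine ⟨π ++ [β], ?_, ?_, ?_, by simp, ?_⟩
      · rwa [List.head?_append_of_ne_nil _ hne]
      · rw [List.isChain_append]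
        refine ⟨h2, by simp, ?_⟩
        simp [h4, hδ]
      · simp only [List.mem_append, List.mem_singleton]
        rintro α (h | rfl)
        · exact (h3 α h).trans hδ.le
        · exact le_rfl
      · rw [List.map_append, List.sum_append, ← h5, growthTime_eq w β, add_comm]
        simp only [List.map_cons, List.map_nil, List.sum_cons, List.sum_nil, add_zero]
        congr 1
        exact le_antisymm (readyTime_le fun x hx => (hmax x hx).trans (growthTime_mono w hγδ))
          (growthTime_le_readyTime w hδ.lt)

theorem passageValue_le_iff (hΛ : IsLocallyFinitePoset Λ) {g : Λ → ℝ} (hg : ∀ α, 0 ≤ g α)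
    (A : FinLowerSet Λ) (t : ℝ≥0) :
    passageValue g A ≤ t ↔ A.1 ⊆ grownSet (fun α => ENNReal.ofReal (g α)) t := by
  set w : Λ → ℝ≥0∞ := fun α => ENNReal.ofReal (g α)
  have hcoe : ∀ x : ℝ, ENNReal.ofReal x ≤ t ↔ x ≤ t := fun x => by
    exact ENNReal.ofReal_le_iff_le_toReal ENNReal.coe_ne_top
  constructor
  · intro h β hβ
    obtain ⟨π, h1, h2, h3, -, h5⟩ := exists_path_growthTime hΛ w β
    have hπ : π ∈ paths A := ⟨h1, h2, fun α hα => A.2.2 (h3 α hα) hβ⟩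
    -- The path to `β` need not be maximal in `A`. A longest extension is, and nonnegative weights
    -- make its sum at least as large.
    obtain ⟨π', ⟨hπ', hpre⟩, hmax⟩ := Set.exists_max_image {π' | π' ∈ paths A ∧ π <+: π'}
      List.length ((paths_finite A).subset fun _ h => h.1) ⟨π, hπ, List.prefix_rfl⟩
    have hmem : π' ∈ maxPaths A := ⟨hπ', fun π'' h'' hpre' =>
      (hpre'.eq_of_length_le (hmax π'' ⟨h'', hpre.trans hpre'⟩)).symm⟩
    have hle := (isGreatest_passageValue g A).2 (Set.mem_image_of_mem _ hmem)
    obtain ⟨ρ, rfl⟩ := hpre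
    change growthTime w β ≤ t
    rw [h5, sum_map_ofReal hg, hcoe]
    refine le_trans ?_ (hle.trans h)
    simp only [List.map_append, List.sum_append, le_add_iff_nonneg_right]
    exact List.sum_nonneg (by simpa using fun α _ => hg α)
  · intro h
    obtain ⟨π, hπ, heq⟩ := (isGreatest_passageValue g A).1
    rw [← heq]
    change (π.map g).sum ≤ t
    rw [← hcoe, ← sum_map_ofReal hg]
    cases π with
    | nil => simp
    | cons a l =>
      refine le_trans ?_ (h (hπ.1.2.2 _ (List.getLast_mem (List.cons_ne_nil a l))))
      refine le_trans ?_ (growthTime_add_sum_le w l a hπ.1.2.1)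
      rw [List.map_cons, List.sum_cons]
      exact add_le_add_left ((growthTime_eq w a).symm ▸ le_self_add) _

theorem lppSet_eq_grownSet (hΛ : IsLocallyFinitePoset Λ) {g : Λ → ℝ} (hg : ∀ α, 0 ≤ g α)
    (t : ℝ≥0) : lppSet g t = grownSet (fun α => ENNReal.ofReal (g α)) t := by
  ext β
  simp only [lppSet, Set.mem_ofPred_eq, Set.mem_iUnion, exists_prop]
  constructor
  · rintro ⟨A, hA, hβ⟩
    exact (passageValue_le_iff hΛ hg A t).1 hA hβ
  · intro hβ
    refine ⟨principalLower hΛ β, (passageValue_le_iff hΛ hg _ t).2 fun γ hγ => ?_, le_refl β⟩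
    exact isLowerSet_grownSet _ t hγ hβ

theorem lppState_eq_growthState (hΛ : IsLocallyFinitePoset Λ) {g : Λ → ℝ} (hg : ∀ α, 0 ≤ g α)
    (t : ℝ≥0) : lppState g t = growthState (fun α => ENNReal.ofReal (g α)) t := by
  refine Option.ext fun A => ?_
  rw [lppState_eq_some, growthState_eq_some, lppSet_eq_grownSet hΛ hg t]

end Deterministic

/-! ### Families of independent exponential weights -/

theorem expMeasure_apply (l : ℝ) {T : Set ℝ} (hT : MeasurableSet T) :
    expMeasure l T = ∫⁻ x, T.indicator (exponentialPDF l) x := by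
  rw [expMeasure, gammaMeasure, withDensity_apply _ hT, lintegral_indicator hT]
  rfl

/-- Memorylessness, by translating the density. The case of the full line gives the tail, and with
it the product form `expMeasure_shift`. -/
theorem expMeasure_shift_eq {l r : ℝ} (hr : 0 ≤ r) {T : Set ℝ}
    (hT : MeasurableSet T) :
    expMeasure l {x | r < x ∧ x - r ∈ T} =
      ENNReal.ofReal (Real.exp (-(l * r))) * expMeasure l T := by
  have hS : MeasurableSet {x : ℝ | r < x ∧ x - r ∈ T} :=
    measurableSet_Ioi.inter ((measurable_id.sub_const r) hT)
  have hpdf : Measurable (exponentialPDF l) := (measurable_exponentialPDFReal l).ennreal_ofReal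
  rw [expMeasure_apply l hS, expMeasure_apply l hT,
    ← lintegral_const_mul _ (hpdf.indicator hT), ← lintegral_add_right_eq_self _ r]
  refine lintegral_congr_ae ?_
  -- At `y = 0` the two integrands may differ, since the density is already positive there while `r
  -- < x` is strict.
  have h0 : ∀ᵐ y : ℝ, y ≠ 0 := by simp [ae_iff, measure_singleton]
  filter_upwards [h0] with y hy
  rcases lt_or_gt_of_ne hy with h | h
  · rw [Set.indicator_of_notMem]
    · by_cases hyT : y ∈ T
      · rw [Set.indicator_of_mem hyT, exponentialPDF_of_neg h, mul_zero]
      · rw [Set.indicator_of_notMem hyT, mul_zero]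
    · rintro ⟨h', -⟩
      linarith
  · by_cases hyT : y ∈ T
    · rw [Set.indicator_of_mem hyT, Set.indicator_of_mem,
        exponentialPDF_of_nonneg h.le, exponentialPDF_of_nonneg (by linarith),
        ← ENNReal.ofReal_mul (Real.exp_pos _).le]
      · congr 1
        rw [show -(l * (y + r)) = -(l * r) + -(l * y) by ring, Real.exp_add]
        ring
      · exact ⟨by linarith, by simpa using hyT⟩
    · rw [Set.indicator_of_notMem hyT, mul_zero, Set.indicator_of_notMem]
      rintro ⟨-, h'⟩
      exact hyT (by simpa using h')

theorem expMeasure_Ioi {l r : ℝ} (hl : 0 < l) (hr : 0 ≤ r) :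
    expMeasure l (Set.Ioi r) = ENNReal.ofReal (Real.exp (-(l * r))) := by
  have := isProbabilityMeasure_expMeasure hl
  have h := expMeasure_shift_eq (l := l) hr MeasurableSet.univ
  simpa [Set.Ioi] using h

theorem expMeasure_shift {l r : ℝ} (hl : 0 < l) (hr : 0 ≤ r) {T : Set ℝ}
    (hT : MeasurableSet T) :
    expMeasure l {x | r < x ∧ x - r ∈ T} = expMeasure l (Set.Ioi r) * expMeasure l T := by
  rw [expMeasure_shift_eq hr hT, expMeasure_Ioi hl hr]

theorem expMeasure_Iic {l r : ℝ} (hl : 0 < l) (hr : 0 ≤ r) :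
    expMeasure l (Set.Iic r) = ENNReal.ofReal (1 - Real.exp (-(l * r))) := by
  have := isProbabilityMeasure_expMeasure hl
  rw [← Set.compl_Ioi, prob_compl_eq_one_sub measurableSet_Ioi, expMeasure_Ioi hl hr,
    ENNReal.ofReal_sub _ (Real.exp_pos _).le, ENNReal.ofReal_one]

section Weights

variable {Λ : Type*}

/-- The joint law of independent exponential weights. -/
def weightLaw (rate : Λ → ℝ) : Measure (Λ → ℝ) :=
  Measure.infinitePi fun α => expMeasure (rate α)

theorem isProbabilityMeasure_weightLaw {rate : Λ → ℝ} (hrate : ∀ α, 0 < rate α) :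
    IsProbabilityMeasure (weightLaw rate) := by
  have := fun α => isProbabilityMeasure_expMeasure (hrate α)
  unfold weightLaw
  infer_instance

theorem weightLaw_pi {rate : Λ → ℝ} (hrate : ∀ α, 0 < rate α) (s : Finset Λ) {t : Λ → Set ℝ}
    (ht : ∀ α ∈ s, MeasurableSet (t α)) :
    weightLaw rate (Set.pi s t) = ∏ α ∈ s, expMeasure (rate α) (t α) := by
  have := fun α => isProbabilityMeasure_expMeasure (hrate α)
  exact Measure.infinitePi_pi _ ht

theorem ae_weightLaw_pos [Countable Λ] {rate : Λ → ℝ} (hrate : ∀ α, 0 < rate α) :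
    ∀ᵐ z ∂weightLaw rate, ∀ α, 0 < z α := by
  have := isProbabilityMeasure_weightLaw hrate
  rw [ae_all_iff]
  intro α
  have h := weightLaw_pi hrate {α} (t := fun _ => Set.Ioi 0) fun _ _ => measurableSet_Ioi
  have hset : Set.pi (({α} : Finset Λ) : Set Λ) (fun _ => Set.Ioi (0 : ℝ)) = {z | 0 < z α} := by
    ext z
    simp
  rw [hset, Finset.prod_singleton, expMeasure_Ioi (hrate α) le_rfl] at h
  have hm : MeasurableSet {z : Λ → ℝ | 0 < z α} := measurableSet_lt measurable_const (by fun_prop)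
  exact (prob_compl_eq_zero_iff hm).2 (by simpa using h)

/-- Joint memorylessness: given that the weights in `K` exceed their thresholds, the residual
weights have the original law. It is enough to compare boxes, where the claim factors over
coordinates. -/
theorem weightLaw_shift {rate : Λ → ℝ} (hrate : ∀ α, 0 < rate α) (K : Finset Λ) {r : Λ → ℝ}
    (hr : ∀ α, 0 ≤ r α) (hK : ∀ α ∉ K, r α = 0) {E : Set (Λ → ℝ)} (hE : MeasurableSet E) :
    weightLaw rate {y | (∀ α ∈ K, r α < y α) ∧ (fun α => y α - r α) ∈ E} =
      weightLaw rate {y | ∀ α ∈ K, r α < y α} * weightLaw rate E := by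
  classical
  have := isProbabilityMeasure_weightLaw hrate
  have hprob := fun α => isProbabilityMeasure_expMeasure (hrate α)
  set U : Set (Λ → ℝ) := {y | ∀ α ∈ K, r α < y α} with hU
  have hUpi : U = Set.pi K fun α => Set.Ioi (r α) := by
    ext y
    simp [hU]
  have hUm : MeasurableSet U := by
    rw [hUpi]
    exact MeasurableSet.pi K.countable_toSet fun _ _ => measurableSet_Ioi
  have hUval : weightLaw rate U = ∏ α ∈ K, expMeasure (rate α) (Set.Ioi (r α)) := by
    rw [hUpi, weightLaw_pi hrate K fun _ _ => measurableSet_Ioi]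
  have hU0 : weightLaw rate U ≠ 0 := by
    rw [hUval, Finset.prod_ne_zero_iff]
    intro α _
    rw [expMeasure_Ioi (hrate α) (hr α)]
    simp [Real.exp_pos]
  have hφ : Measurable fun (y : Λ → ℝ) α => y α - r α := by fun_prop
  have key : (cond (weightLaw rate) U).map (fun y α => y α - r α) = weightLaw rate := by
    refine Measure.eq_infinitePi _ fun s t ht => ?_
    rw [Measure.map_apply hφ (MeasurableSet.pi s.countable_toSet fun α _ => ht α),
      cond_apply hUm]
    have hset : U ∩ (fun (y : Λ → ℝ) α => y α - r α) ⁻¹' Set.pi s t =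
        Set.pi (K ∪ s : Finset Λ)
          fun α => {x | (α ∈ K → r α < x) ∧ (α ∈ s → x - r α ∈ t α)} := by
      ext y
      simp only [hU, Set.mem_inter_iff, Set.mem_ofPred_eq, Set.mem_preimage, Set.mem_pi,
        Finset.coe_union, Set.mem_union, Finset.mem_coe]
      constructor
      · exact fun h α _ => ⟨h.1 α, h.2 α⟩
      · exact fun h => ⟨fun α hα => (h α (Or.inl hα)).1 hα, fun α hα => (h α (Or.inr hα)).2 hα⟩
    rw [hset, weightLaw_pi hrate]
    · have hfac : ∀ α ∈ K ∪ s, expMeasure (rate α)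
          {x | (α ∈ K → r α < x) ∧ (α ∈ s → x - r α ∈ t α)} =
          (if α ∈ K then expMeasure (rate α) (Set.Ioi (r α)) else 1) *
            (if α ∈ s then expMeasure (rate α) (t α) else 1) := by
        intro α hα
        by_cases h1 : α ∈ K <;> by_cases h2 : α ∈ s
        · simp only [h1, h2, true_imp_iff, if_true]
          exact expMeasure_shift (hrate α) (hr α) (ht α)
        · simp only [h1, h2, true_imp_iff, if_true, false_imp_iff, and_true, if_false, mul_one]
          rfl
        · simp only [h1, h2, true_imp_iff, if_true, false_imp_iff, true_and, if_false, one_mul,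
            hK α h1, sub_zero]
          rfl
        · simp [h1, h2] at hα
      rw [Finset.prod_congr rfl hfac, Finset.prod_mul_distrib, Finset.prod_ite_mem,
        Finset.prod_ite_mem, Finset.union_inter_cancel_left, Finset.union_inter_cancel_right,
        ← hUval, ← mul_assoc, ENNReal.inv_mul_cancel hU0 (measure_ne_top _ _), one_mul]
    · intro α _
      refine MeasurableSet.inter ?_ ?_
      · exact MeasurableSet.imp (MeasurableSet.const _) measurableSet_Ioi
      · exact MeasurableSet.imp (MeasurableSet.const _) ((measurable_id.sub_const (r α)) (ht α))
  have h := congrArg (fun m => m E) key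
  rw [Measure.map_apply hφ hE, cond_apply hUm] at h
  rw [← h, ← mul_assoc, ENNReal.mul_inv_cancel hU0 (measure_ne_top _ _), one_mul]
  rfl

open Classical in
/-- The family that agrees with the first one on `A` and with the second one off `A`. -/
def mergeOn (A : Set Λ) (p : (Λ → ℝ) × (Λ → ℝ)) (α : Λ) : ℝ := if α ∈ A then p.1 α else p.2 α

theorem mergeOn_of_mem {A : Set Λ} {α : Λ} (h : α ∈ A) (p : (Λ → ℝ) × (Λ → ℝ)) :
    mergeOn A p α = p.1 α := if_pos h

theorem mergeOn_of_notMem {A : Set Λ} {α : Λ} (h : α ∉ A) (p : (Λ → ℝ) × (Λ → ℝ)) :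
    mergeOn A p α = p.2 α := if_neg h

theorem measurable_mergeOn (A : Set Λ) : Measurable (mergeOn A) := by
  refine measurable_pi_iff.2 fun α => ?_
  by_cases h : α ∈ A
  · simp only [mergeOn_of_mem h]
    fun_prop
  · simp only [mergeOn_of_notMem h]
    fun_prop

/-- Independence of the weights on and off `A`, in a form ready for Fubini: one independent copy
supplies the past, the other the future. -/
theorem map_mergeOn_weightLaw {rate : Λ → ℝ} (hrate : ∀ α, 0 < rate α) (A : Set Λ) :
    ((weightLaw rate).prod (weightLaw rate)).map (mergeOn A) = weightLaw rate := by
  classical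
  have := isProbabilityMeasure_weightLaw hrate
  have hprob := fun α => isProbabilityMeasure_expMeasure (hrate α)
  refine Measure.eq_infinitePi _ fun s t ht => ?_
  rw [Measure.map_apply (measurable_mergeOn A)
    (MeasurableSet.pi s.countable_toSet fun α _ => ht α)]
  have hset : mergeOn A ⁻¹' Set.pi s t =
      Set.pi (s.filter (· ∈ A) : Finset Λ) t ×ˢ Set.pi (s.filter (· ∉ A) : Finset Λ) t := by
    ext p
    simp only [Set.mem_preimage, Set.mem_pi, Set.mem_prod, Finset.coe_filter, Finset.mem_coe,
      Set.mem_ofPred_eq]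
    constructor
    · exact fun h => ⟨fun α hα => mergeOn_of_mem hα.2 p ▸ h α hα.1,
        fun α hα => mergeOn_of_notMem hα.2 p ▸ h α hα.1⟩
    · intro h α hα
      by_cases hA : α ∈ A
      · rw [mergeOn_of_mem hA]
        exact h.1 α ⟨hα, hA⟩
      · rw [mergeOn_of_notMem hA]
        exact h.2 α ⟨hα, hA⟩
  rw [hset, Measure.prod_prod, weightLaw_pi hrate _ fun α _ => ht α,
    weightLaw_pi hrate _ fun α _ => ht α, Finset.prod_filter_mul_prod_filter_not]

end Weights

/-! ### Discrete state spaces and expansions for small times -/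

section General

variable {E Ω : Type*}

theorem hasSum_measureReal_inter_state [MeasurableSpace Ω] [Countable E] {μ : Measure Ω}
    [IsFiniteMeasure μ] {f : Ω → Option E} (hf : ∀ b, MeasurableSet {ω | f ω = some b}) {F : Set Ω}
    (hF : MeasurableSet F) :
    HasSum (fun b => μ.real (F ∩ {ω | f ω = some b})) (μ.real (F ∩ {ω | f ω ≠ none})) := by
  have hU : F ∩ {ω | f ω ≠ none} = ⋃ b, F ∩ {ω | f ω = some b} := by
    ext ω
    simp [Option.ne_none_iff_exists']
  have hsum : μ (F ∩ {ω | f ω ≠ none}) = ∑' b, μ (F ∩ {ω | f ω = some b}) := by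
    rw [hU, measure_iUnion _ fun b => hF.inter (hf b)]
    intro b c hbc
    refine Set.disjoint_left.2 fun ω h h' => hbc ?_
    exact Option.some.inj (h.2.symm.trans h'.2)
  have hne : ∑' b, μ (F ∩ {ω | f ω = some b}) ≠ ∞ := hsum ▸ measure_ne_top _ _
  have h := (ENNReal.summable_toReal hne).hasSum
  rw [← ENNReal.tsum_toReal_eq fun b => measure_ne_top _ _, ← hsum] at h
  exact h

theorem exists_preimage_of_measurableSet_history {X : ℝ≥0 → Ω → Option E} {s : ℝ≥0} {F : Set Ω}
    (hF : MeasurableSet[history X s] F) :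
    ∃ S : Set (Set.Iic s → Option E), MeasurableSet[@MeasurableSpace.pi _ _ fun _ => ⊤] S ∧
      F = (fun ω (r : Set.Iic s) => X r.1 ω) ⁻¹' S := by
  have h : history X s = MeasurableSpace.comap (fun ω (r : Set.Iic s) => X r.1 ω)
      (@MeasurableSpace.pi _ _ fun _ => ⊤) := by
    simp only [history, MeasurableSpace.pi, MeasurableSpace.comap_iSup,
      MeasurableSpace.comap_comp]
    rw [iSup_subtype]
    rfl
  rw [h] at hF
  obtain ⟨S, hS, rfl⟩ := hF
  exact ⟨S, hS, rfl⟩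

/-- Removing the masses `l i` from `p` at the distinct points `c i` leaves a nonnegative remainder
of total mass at most `1 - ∑ l i`. Lower bounds on finitely many probabilities therefore suffice to
find the generator. -/
theorem abs_tsum_sub_sum_le {ι : Type*} [Fintype ι] {p f : E → ℝ} (hp : ∀ b, 0 ≤ p b)
    (hsum : Summable p) (hle : ∑' b, p b ≤ 1) {C : ℝ} (hC0 : 0 ≤ C)
    (hf : ∀ b, |f b| ≤ C) {c : ι → E}
    (hc : Function.Injective c) {l : ι → ℝ} (hl : ∀ i, l i ≤ p (c i)) :
    |∑' b, p b * f b - ∑ i, l i * f (c i)| ≤ C * (1 - ∑ i, l i) := by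
  classical
  -- The measure with mass `l i` at `c i`, which `p` dominates.
  set k : E → ℝ := fun b => ∑ i, if b = c i then l i else 0 with hk
  have hkp : ∀ b, k b ≤ p b := by
    intro b
    by_cases h : ∃ i, b = c i
    · obtain ⟨i, rfl⟩ := h
      have : k (c i) = l i := by
        rw [hk]
        simp only [hc.eq_iff]
        simp
      rw [this]
      exact hl i
    · have : k b = 0 := Finset.sum_eq_zero fun i _ => if_neg fun h' => h ⟨i, h'⟩
      rw [this]
      exact hp b
  have hks : HasSum k (∑ i, l i) := by
    refine hasSum_sum fun i _ => ?_
    exact hasSum_ite_eq (c i) (l i)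
  have hkf : HasSum (fun b => k b * f b) (∑ i, l i * f (c i)) := by
    have : (fun b => k b * f b) = fun b => ∑ i, if b = c i then l i * f (c i) else 0 := by
      funext b
      rw [hk, Finset.sum_mul]
      refine Finset.sum_congr rfl fun i _ => ?_
      split_ifs with h
      · rw [h]
      · rw [zero_mul]
    rw [this]
    exact hasSum_sum fun i _ => hasSum_ite_eq (c i) (l i * f (c i))
  have hpf : Summable fun b => p b * f b := by
    refine Summable.of_norm_bounded (hsum.mul_right C) fun b => ?_
    rw [Real.norm_eq_abs, abs_mul, abs_of_nonneg (hp b)]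
    exact mul_le_mul_of_nonneg_left (hf b) (hp b)
  have hv : HasSum (fun b => (p b - k b) * f b) (∑' b, p b * f b - ∑ i, l i * f (c i)) := by
    simpa only [sub_mul] using hpf.hasSum.sub hkf
  have hvs := hsum.hasSum.sub hks
  have hvC : HasSum (fun b => C * (p b - k b)) (C * (∑' b, p b - ∑ i, l i)) := hvs.mul_left C
  have hbound : ∀ b, |(p b - k b) * f b| ≤ C * (p b - k b) := fun b => by
    rw [abs_mul, abs_of_nonneg (sub_nonneg.2 (hkp b)), mul_comm]
    exact mul_le_mul_of_nonneg_right (hf b) (sub_nonneg.2 (hkp b))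
  rw [← hv.tsum_eq]
  have h1 : ‖∑' b, (p b - k b) * f b‖ ≤ C * (∑' b, p b - ∑ i, l i) :=
    tsum_of_norm_bounded hvC hbound
  refine h1.trans ?_
  exact mul_le_mul_of_nonneg_left (by linarith) hC0

theorem tendsto_coe_nhdsGT_zero :
    Tendsto (fun h : ℝ≥0 => (h : ℝ)) (𝓝[>] 0) (𝓝[>] 0) := by
  refine tendsto_nhdsWithin_iff.2 ⟨?_, ?_⟩
  · exact (NNReal.continuous_coe.tendsto 0).mono_left nhdsWithin_le_nhds
  · filter_upwards [self_mem_nhdsWithin] with h hh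
    exact NNReal.coe_pos.2 hh

/-- The derivative at `0` of the mean under the lower bounds for staying and for one step. The rates
`q i` out of the new state multiply a factor vanishing at `0`, so they drop out. -/
theorem tendsto_exp_slope {ι : Type*} [Fintype ι] (l q f : ι → ℝ) (x : ℝ) :
    Tendsto (fun h : ℝ≥0 => (Real.exp (-((∑ i, l i) * h)) * x +
        ∑ i, (1 - Real.exp (-(l i * h))) * Real.exp (-(q i * h)) * f i - x) / h)
      (𝓝[>] 0) (𝓝 (∑ i, l i * (f i - x))) := by
  have hexp : ∀ c : ℝ, HasDerivAt (fun h : ℝ => Real.exp (-(c * h))) (-c) 0 := by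
    intro c
    have := ((hasDerivAt_id (0 : ℝ)).const_mul c).neg.exp
    simpa using this
  have hd : HasDerivAt (fun h : ℝ => Real.exp (-((∑ i, l i) * h)) * x +
      ∑ i, (1 - Real.exp (-(l i * h))) * Real.exp (-(q i * h)) * f i)
      (∑ i, l i * (f i - x)) 0 := by
    have h1 := (hexp (∑ i, l i)).mul_const x
    have h2 : HasDerivAt (fun h : ℝ => ∑ i, (1 - Real.exp (-(l i * h))) *
        Real.exp (-(q i * h)) * f i) (∑ i, l i * f i) 0 := by
      refine HasDerivAt.fun_sum fun i _ => ?_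
      have := (((hexp (l i)).const_sub 1).mul (hexp (q i))).mul_const (f i)
      simpa using this
    have h3 := h1.add h2
    have he : -(∑ i, l i) * x + ∑ i, l i * f i = ∑ i, l i * (f i - x) := by
      simp only [mul_sub, Finset.sum_sub_distrib, ← Finset.sum_mul]
      ring
    rw [he] at h3
    exact h3
  have hs := (hd.tendsto_slope_zero_right).comp tendsto_coe_nhdsGT_zero
  refine hs.congr fun h => ?_
  simp [div_eq_inv_mul]

end General

open Classical in
/-- The weights `g`, replaced by `0` on `A`. -/
def startWeights {Λ : Type*} (A : Set Λ) (g : Λ → ℝ) (β : Λ) : ℝ≥0∞ :=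
  if β ∈ A then 0 else ENNReal.ofReal (g β)

theorem startWeights_of_mem {Λ : Type*} {A : Set Λ} {β : Λ} (h : β ∈ A) (g : Λ → ℝ) :
    startWeights A g β = 0 := if_pos h

theorem startWeights_of_notMem {Λ : Type*} {A : Set Λ} {β : Λ} (h : β ∉ A) (g : Λ → ℝ) :
    startWeights A g β = ENNReal.ofReal (g β) := if_neg h

theorem measurable_startWeights {Λ : Type*} (A : Set Λ) :
    Measurable (startWeights A) := by
  refine measurable_pi_iff.2 fun β => ?_
  by_cases h : β ∈ A
  · simp only [startWeights_of_mem h]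
    exact measurable_const
  · simp only [startWeights_of_notMem h]
    exact (measurable_pi_apply β).ennreal_ofReal

theorem startWeights_mergeOn {Λ : Type*} [PartialOrder Λ] {A₀ A : FinLowerSet Λ}
    {x y : Λ → ℝ} {β : Λ} (h : β ∈ A.1) :
    startWeights A₀.1 (mergeOn A.1 (x, y)) β = startWeights A₀.1 x β := by
  unfold startWeights
  rw [mergeOn_of_mem h]

/-! ### Growth from a given state and its Markov property -/

section Canonical

variable {Λ : Type*} [PartialOrder Λ] [WellFoundedLT Λ]

theorem measurable_growthState [Countable Λ] (t : ℝ≥0) :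
    Measurable fun w : Λ → ℝ≥0∞ => growthState w t := by
  have := FinLowerSet.countable (Λ := Λ)
  have hsome : ∀ B, MeasurableSet {w : Λ → ℝ≥0∞ | growthState w t = some B} := by
    intro B
    have : {w : Λ → ℝ≥0∞ | growthState w t = some B} =
        ⋂ β, {w | growthTime w β ≤ t ↔ β ∈ B.1} := by
      ext w
      simp only [Set.mem_ofPred_eq, growthState_eq_some, Set.mem_iInter, Set.ext_iff,
        mem_grownSet]
    rw [this]
    exact MeasurableSet.iInter fun β => MeasurableSet.iff
      (measurableSet_le (measurable_growthTime β) measurable_const) (MeasurableSet.const _)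
  refine measurable_to_countable' fun o => ?_
  cases o with
  | some B => exact hsome B
  | none =>
    have : (fun w : Λ → ℝ≥0∞ => growthState w t) ⁻¹' {none} =
        (⋃ B, {w : Λ → ℝ≥0∞ | growthState w t = some B})ᶜ := by
      ext w
      simp only [Set.mem_preimage, Set.mem_singleton_iff, Set.mem_compl_iff, Set.mem_iUnion,
        Set.mem_ofPred_eq, not_exists]
      exact Option.eq_none_iff_forall_ne_some
    rw [this]
    exact (MeasurableSet.iUnion hsome).compl

/-- The growth process with weights `g` started from `A`. -/
def growFrom (A : FinLowerSet Λ) (g : Λ → ℝ) (t : ℝ≥0) : Option (FinLowerSet Λ) :=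
  growthState (startWeights A.1 g) t

theorem measurable_growFrom [Countable Λ] (A : FinLowerSet Λ) (t : ℝ≥0) :
    Measurable fun g => growFrom A g t :=
  (measurable_growthState t).comp (measurable_startWeights A.1)

theorem measurableSet_growFrom_eq [Countable Λ] (A : FinLowerSet Λ) (t : ℝ≥0)
    (o : Option (FinLowerSet Λ)) : MeasurableSet {g | growFrom A g t = o} :=
  measurable_growFrom A t (MeasurableSet.of_discrete (s := {o}))

theorem growthTime_startWeights_of_mem (A : FinLowerSet Λ) (g : Λ → ℝ) {β : Λ} (h : β ∈ A.1) :
    growthTime (startWeights A.1 g) β = 0 :=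
  growthTime_eq_zero β fun _ hγ => startWeights_of_mem (A.2.2 hγ h) g

theorem growthTime_startWeights_of_growth (A : FinLowerSet Λ) (g : Λ → ℝ) {α : Λ}
    (h : α ∈ growthElements A) :
    growthTime (startWeights A.1 g) α = ENNReal.ofReal (g α) := by
  rw [growthTime_eq, startWeights_of_notMem h.1, readyTime_eq_zero, add_zero]
  exact fun γ hγ => startWeights_of_mem (mem_of_lt_growthElement h hγ) g

theorem growFrom_eq_self_iff (A : FinLowerSet Λ) (g : Λ → ℝ) (t : ℝ≥0) :
    growFrom A g t = some A ↔ ∀ α ∈ growthElements A, (t : ℝ) < g α := by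
  rw [growFrom, growthState_eq_some, grownSet_eq_iff, and_iff_right]
  · refine forall₂_congr fun α hα => ?_
    rw [growthTime_startWeights_of_growth A g hα,
      ENNReal.lt_ofReal_iff_toReal_lt ENNReal.coe_ne_top, ENNReal.coe_toReal]
  · intro β hβ
    rw [growthTime_startWeights_of_mem A g hβ]
    exact zero_le

theorem subset_of_growFrom_eq {A B : FinLowerSet Λ} {g : Λ → ℝ} {t : ℝ≥0}
    (h : growFrom A g t = some B) : A.1 ⊆ B.1 := by
  intro β hβ
  rw [growFrom, growthState_eq_some] at h
  rw [← h, mem_grownSet, growthTime_startWeights_of_mem A g hβ]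
  exact zero_le

/-- Only a sufficient condition: each new growth element is treated as if its clock had started at
time `0`. This makes the event a box in independent weights, and the loss does not matter to first
order. -/
theorem growFrom_eq_grow (A : FinLowerSet Λ) (α : growthElements A) {g : Λ → ℝ} {t : ℝ≥0}
    (hα : g α.1 ≤ t) (h : ∀ β ∈ growthElements (grow A α), (t : ℝ) < g β) :
    growFrom A g t = some (grow A α) := by
  rw [growFrom, growthState_eq_some, grownSet_eq_iff]
  constructor
  · rintro β (rfl | hβ)
    · rw [growthTime_startWeights_of_growth A g α.2]
      exact ENNReal.ofReal_le_of_le_toReal hα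
    · rw [growthTime_startWeights_of_mem A g hβ]
      exact zero_le
  · intro β hβ
    have hβA : β ∉ A.1 := fun h => hβ.1 (Or.inr h)
    rw [growthTime_eq, startWeights_of_notMem hβA]
    refine lt_of_lt_of_le ?_ le_self_add
    rw [ENNReal.lt_ofReal_iff_toReal_lt ENNReal.coe_ne_top, ENNReal.coe_toReal]
    exact h β hβ

/-- The time that a growth element `α` of the state `A` at time `s` has already waited. -/
def waited (A₀ A : FinLowerSet Λ) (s : ℝ≥0) (x : Λ → ℝ) (α : Λ) : ℝ :=
  open Classical in
  if α ∈ growthElements A then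
    ((s : ℝ≥0∞) - readyTime (startWeights A₀.1 x) α).toReal else 0

theorem waited_nonneg (A₀ A : FinLowerSet Λ) (s : ℝ≥0) (x : Λ → ℝ) (α : Λ) :
    0 ≤ waited A₀ A s x α := by
  unfold waited
  split_ifs
  · exact ENNReal.toReal_nonneg
  · exact le_rfl

theorem growthTime_mergeOn {A₀ A : FinLowerSet Λ} {x y : Λ → ℝ} {β : Λ} (h : β ∈ A.1) :
    growthTime (startWeights A₀.1 (mergeOn A.1 (x, y))) β = growthTime (startWeights A₀.1 x) β :=
  growthTime_congr β fun _ hγ => startWeights_mergeOn (A.2.2 hγ h)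

theorem readyTime_mergeOn {A₀ A : FinLowerSet Λ} {x y : Λ → ℝ} {α : Λ}
    (h : α ∈ growthElements A) :
    readyTime (startWeights A₀.1 (mergeOn A.1 (x, y))) α = readyTime (startWeights A₀.1 x) α :=
  readyTime_congr α fun _ hγ => startWeights_mergeOn (mem_of_lt_growthElement h hγ)

/-- The waited times depend only on the weights `x` on `A`. For fixed `x` the event is therefore
empty or a box in `y`, as `weightLaw_shift` requires. -/
theorem growFrom_mergeOn_eq_iff {A₀ A : FinLowerSet Λ} (hA : A₀.1 ⊆ A.1) (s : ℝ≥0)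
    (x y : Λ → ℝ) :
    growFrom A₀ (mergeOn A.1 (x, y)) s = some A ↔
      (∀ β ∈ A.1, growthTime (startWeights A₀.1 x) β ≤ s) ∧
        ∀ α ∈ growthElements A, waited A₀ A s x α < y α := by
  rw [growFrom, growthState_eq_some, grownSet_eq_iff]
  have h1 : (∀ β ∈ A.1, growthTime (startWeights A₀.1 (mergeOn A.1 (x, y))) β ≤ s) ↔
      ∀ β ∈ A.1, growthTime (startWeights A₀.1 x) β ≤ s :=
    forall₂_congr fun β hβ => by rw [growthTime_mergeOn hβ]
  rw [h1]
  refine and_congr_right fun hle => forall₂_congr fun α hα => ?_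
  have hr : readyTime (startWeights A₀.1 x) α ≤ s :=
    readyTime_le fun γ hγ => hle γ (mem_of_lt_growthElement hα hγ)
  rw [growthTime_eq, readyTime_mergeOn hα, startWeights_of_notMem fun h => hα.1 (hA h),
    mergeOn_of_notMem hα.1, waited, if_pos hα,
    ← ENNReal.lt_ofReal_iff_toReal_lt (ENNReal.sub_ne_top ENNReal.coe_ne_top),
    ENNReal.sub_lt_iff_lt_right (ne_top_of_le_ne_top ENNReal.coe_ne_top hr) hr]

theorem growFrom_mergeOn_add {A₀ A : FinLowerSet Λ} {s : ℝ≥0} {x y : Λ → ℝ}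
    (h : growFrom A₀ (mergeOn A.1 (x, y)) s = some A) (t : ℝ≥0) :
    growFrom A₀ (mergeOn A.1 (x, y)) (s + t) =
      growFrom A (fun α => y α - waited A₀ A s x α) t := by
  have hA := subset_of_growFrom_eq h
  have hle := ((growFrom_mergeOn_eq_iff hA s x y).1 h).1
  refine Option.ext fun B => ?_
  rw [growFrom, growthState_eq_some] at h
  rw [growFrom, growFrom, growthState_eq_some, growthState_eq_some]
  rw [grownSet_add_eq (w' := startWeights A.1 fun α => y α - waited A₀ A s x α) h]
  · exact fun β hβ => startWeights_of_mem hβ _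
  · intro β hβ
    have hr : (s : ℝ≥0∞) - readyTime (startWeights A₀.1 x) β ≠ ∞ :=
      ENNReal.sub_ne_top ENNReal.coe_ne_top
    rw [startWeights_of_notMem hβ.1, startWeights_of_notMem fun h => hβ.1 (hA h),
      readyTime_mergeOn hβ, mergeOn_of_notMem hβ.1, ENNReal.ofReal_sub _ (waited_nonneg ..),
      waited, if_pos hβ, ENNReal.ofReal_toReal hr]
  · intro β hβ hβ'
    rw [startWeights_of_notMem hβ, startWeights_of_notMem fun h => hβ (hA h),
      mergeOn_of_notMem hβ, waited, if_neg hβ', sub_zero]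

/-- The history up to a time at which the state is `A`, as a function of the weights on `A`. -/
def pastOf (A₀ A : FinLowerSet Λ) (s : ℝ≥0) (x : Λ → ℝ) (r : Set.Iic s) :
    Option (FinLowerSet Λ) :=
  some ⟨grownSet (startWeights A₀.1 x) r.1 ∩ A.1, A.2.1.inter_of_right _,
    (isLowerSet_grownSet _ _).inter A.2.2⟩

/-- What has been added by time `r ≤ s` lies in `A`, and growth times in the lower set `A` depend
only on weights in `A`. -/
theorem past_mergeOn {A₀ A : FinLowerSet Λ} {s : ℝ≥0} {x y : Λ → ℝ}
    (h : growFrom A₀ (mergeOn A.1 (x, y)) s = some A) :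
    (fun r : Set.Iic s => growFrom A₀ (mergeOn A.1 (x, y)) r.1) = pastOf A₀ A s x := by
  funext r
  rw [growFrom, growthState_eq_some] at h
  refine growthState_eq_some.2 (Set.ext fun β => ?_)
  constructor
  · intro hβ
    have hβA : β ∈ A.1 := h ▸ grownSet_mono _ r.2 hβ
    refine ⟨?_, hβA⟩
    rwa [mem_grownSet, ← growthTime_mergeOn hβA (y := y)]
  · rintro ⟨hβ, hβA⟩
    rwa [mem_grownSet, growthTime_mergeOn hβA]

/-- With the weights on `A` frozen, the past is fixed. Each slice is then either empty or the event
that the growth elements outlast their waited times, which the law of the residual weights ignores.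
-/
theorem growFrom_markov (hΛ : IsLocallyFinitePoset Λ) {rate : Λ → ℝ} (hrate : ∀ α, 0 < rate α)
    (A₀ A B : FinLowerSet Λ) (s h : ℝ≥0) {S : Set (Set.Iic s → Option (FinLowerSet Λ))}
    (hS : MeasurableSet S) :
    weightLaw rate {z | (fun r : Set.Iic s => growFrom A₀ z r.1) ∈ S ∧
        growFrom A₀ z s = some A ∧ growFrom A₀ z (s + h) = some B} =
      weightLaw rate {z | (fun r : Set.Iic s => growFrom A₀ z r.1) ∈ S ∧
        growFrom A₀ z s = some A} * weightLaw rate {z | growFrom A z h = some B} := by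
  have := hΛ.countable
  have := isProbabilityMeasure_weightLaw hrate
  by_cases hA : A₀.1 ⊆ A.1
  swap
  · have hne : ∀ z, growFrom A₀ z s ≠ some A := fun z hz => hA (subset_of_growFrom_eq hz)
    simp [hne]
  set D : Set (Λ → ℝ) := {z | (fun r : Set.Iic s => growFrom A₀ z r.1) ∈ S ∧
    growFrom A₀ z s = some A} with hD
  set D' : Set (Λ → ℝ) := {z | (fun r : Set.Iic s => growFrom A₀ z r.1) ∈ S ∧
    growFrom A₀ z s = some A ∧ growFrom A₀ z (s + h) = some B} with hD'
  have hDm : MeasurableSet D :=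
    ((measurable_pi_iff.2 fun r : Set.Iic s => measurable_growFrom A₀ r.1) hS).inter
      (measurableSet_growFrom_eq A₀ s (some A))
  have hD'm : MeasurableSet D' :=
    ((measurable_pi_iff.2 fun r : Set.Iic s => measurable_growFrom A₀ r.1) hS).inter
      ((measurableSet_growFrom_eq A₀ s (some A)).inter
        (measurableSet_growFrom_eq A₀ (s + h) (some B)))
  have hslice : ∀ T : Set (Λ → ℝ), MeasurableSet T → weightLaw rate T =
      ∫⁻ x, weightLaw rate {y | mergeOn A.1 (x, y) ∈ T} ∂weightLaw rate := by
    intro T hT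
    conv_lhs => rw [← map_mergeOn_weightLaw hrate A.1]
    rw [Measure.map_apply (measurable_mergeOn _) hT,
      Measure.prod_apply (measurable_mergeOn _ hT)]
    rfl
  have hmeas : Measurable fun x => weightLaw rate {y | mergeOn A.1 (x, y) ∈ D} :=
    measurable_measure_prodMk_left (measurable_mergeOn A.1 hDm)
  rw [hslice D hDm, hslice D' hD'm, ← lintegral_mul_const _ hmeas]
  refine lintegral_congr fun x => ?_
  set E : Set (Λ → ℝ) := {z | growFrom A z h = some B} with hE
  have hEm : MeasurableSet E := measurableSet_growFrom_eq A h (some B)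
  set K := (finite_growthElements hΛ A).toFinset with hK
  -- The condition involves `x` alone: all of `A` is added by time `s`, along a history in `S`.
  by_cases hx : (∀ β ∈ A.1, growthTime (startWeights A₀.1 x) β ≤ s) ∧ pastOf A₀ A s x ∈ S
  · have h1 : {y | mergeOn A.1 (x, y) ∈ D} = {y | ∀ α ∈ K, waited A₀ A s x α < y α} := by
      ext y
      simp only [hD, Set.mem_ofPred_eq, hK, Set.Finite.mem_toFinset]
      constructor
      · exact fun hy => ((growFrom_mergeOn_eq_iff hA s x y).1 hy.2).2
      · intro hy
        have h2 := (growFrom_mergeOn_eq_iff hA s x y).2 ⟨hx.1, hy⟩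
        exact ⟨past_mergeOn h2 ▸ hx.2, h2⟩
    have h2 : {y | mergeOn A.1 (x, y) ∈ D'} = {y | (∀ α ∈ K, waited A₀ A s x α < y α) ∧
        (fun α => y α - waited A₀ A s x α) ∈ E} := by
      ext y
      have h3 : mergeOn A.1 (x, y) ∈ D ↔ ∀ α ∈ K, waited A₀ A s x α < y α :=
        Set.ext_iff.1 h1 y
      refine Iff.trans ?_ (and_congr_left' h3)
      constructor
      · rintro ⟨hy1, hy2, hy3⟩
        exact ⟨⟨hy1, hy2⟩, (growFrom_mergeOn_add hy2 h).symm.trans hy3⟩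
      · rintro ⟨⟨hy1, hy2⟩, hy3⟩
        exact ⟨hy1, hy2, (growFrom_mergeOn_add hy2 h).trans hy3⟩
    rw [h1, h2]
    refine weightLaw_shift hrate K (waited_nonneg A₀ A s x) (fun α hα => ?_) hEm
    rw [waited, if_neg]
    simpa [hK] using hα
  · have h1 : {y | mergeOn A.1 (x, y) ∈ D} = ∅ := by
      refine Set.eq_empty_of_forall_notMem fun y hy => hx ?_
      exact ⟨((growFrom_mergeOn_eq_iff hA s x y).1 hy.2).1, past_mergeOn hy.2 ▸ hy.1⟩
    have h2 : {y | mergeOn A.1 (x, y) ∈ D'} = ∅ := by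
      refine Set.eq_empty_of_forall_notMem fun y hy => hx ?_
      exact ⟨((growFrom_mergeOn_eq_iff hA s x y).1 hy.2.1).1, past_mergeOn hy.2.1 ▸ hy.1⟩
    rw [h1, h2]
    simp

end Canonical

/-! ### Transition probabilities and generator of the growth process -/

section Probabilities

variable {Λ : Type*}

theorem weightLaw_real_forall_lt {rate : Λ → ℝ} (hrate : ∀ α, 0 < rate α) (K : Finset Λ)
    (h : ℝ≥0) :
    (weightLaw rate).real {z | ∀ α ∈ K, (h : ℝ) < z α} =
      Real.exp (-((∑ α ∈ K, rate α) * h)) := by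
  have hset : {z : Λ → ℝ | ∀ α ∈ K, (h : ℝ) < z α} = Set.pi K fun _ => Set.Ioi (h : ℝ) := by
    ext z
    simp
  rw [hset, measureReal_def, weightLaw_pi hrate K fun _ _ => measurableSet_Ioi,
    ENNReal.toReal_prod, Finset.sum_mul, ← Finset.sum_neg_distrib, Real.exp_sum]
  refine Finset.prod_congr rfl fun α _ => ?_
  rw [expMeasure_Ioi (hrate α) h.coe_nonneg,
      ENNReal.toReal_ofReal (Real.exp_pos _).le]

theorem weightLaw_real_le_and_forall_lt {rate : Λ → ℝ} (hrate : ∀ α, 0 < rate α) {K : Finset Λ}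
    {α : Λ} (hα : α ∉ K) (h : ℝ≥0) :
    (weightLaw rate).real {z | z α ≤ h ∧ ∀ β ∈ K, (h : ℝ) < z β} =
      (1 - Real.exp (-(rate α * h))) * Real.exp (-((∑ β ∈ K, rate β) * h)) := by
  classical
  have hne : ∀ β ∈ K, β ≠ α := fun β hβ h => hα (h ▸ hβ)
  have hset : {z : Λ → ℝ | z α ≤ h ∧ ∀ β ∈ K, (h : ℝ) < z β} =
      Set.pi (insert α K : Finset Λ)
        fun β => if β = α then Set.Iic (h : ℝ) else Set.Ioi (h : ℝ) := by
    ext z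
    simp only [Set.mem_ofPred_eq, Set.mem_pi, Finset.mem_coe, Finset.mem_insert, forall_eq_or_imp,
      if_true, Set.mem_Iic]
    refine and_congr_right fun _ => forall₂_congr fun β hβ => ?_
    rw [if_neg (hne β hβ), Set.mem_Ioi]
  rw [hset, measureReal_def, weightLaw_pi hrate, Finset.prod_insert hα, if_pos rfl,
    ENNReal.toReal_mul, ENNReal.toReal_prod, expMeasure_Iic (hrate α) h.coe_nonneg,
    ENNReal.toReal_ofReal, Finset.sum_mul, ← Finset.sum_neg_distrib, Real.exp_sum]
  · congr 1
    refine Finset.prod_congr rfl fun β hβ => ?_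
    rw [if_neg (hne β hβ), expMeasure_Ioi (hrate β) h.coe_nonneg,
      ENNReal.toReal_ofReal (Real.exp_pos _).le]
  · have : 0 ≤ rate α * (h : ℝ) := mul_nonneg (hrate α).le h.coe_nonneg
    exact sub_nonneg.2 (Real.exp_le_one_iff.2 (neg_nonpos.2 this))
  · intro β _
    split_ifs
    exacts [measurableSet_Iic, measurableSet_Ioi]

end Probabilities

theorem grow_injective {Λ : Type*} [PartialOrder Λ] (A : FinLowerSet Λ) :
    Function.Injective (fun o : Option (growthElements A) => o.elim A (grow A)) := by
  have hne : ∀ α : growthElements A, grow A α ≠ A := fun α h =>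
    α.2.1 (congrArg Subtype.val h ▸ Set.mem_insert α.1 A.1)
  rintro (_ | α) (_ | β) h
  · rfl
  · exact absurd h.symm (hne β)
  · exact absurd h (hne α)
  · have h0 : insert α.1 A.1 = insert β.1 A.1 := congrArg Subtype.val h
    have h1 : α.1 ∈ insert β.1 A.1 := h0 ▸ Set.mem_insert α.1 A.1
    rcases h1 with h1 | h1
    · exact congrArg some (Subtype.ext h1)
    · exact absurd h1 α.2.1

section Transition

variable {Λ : Type*} [PartialOrder Λ] [WellFoundedLT Λ]

/-- The transition function of the growth process with exponential weights. -/
def transProb (rate : Λ → ℝ) (t : ℝ≥0) (A B : FinLowerSet Λ) : ℝ :=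
  (weightLaw rate).real {z | growFrom A z t = some B}

theorem hasSum_transProb (hΛ : IsLocallyFinitePoset Λ) {rate : Λ → ℝ} (hrate : ∀ α, 0 < rate α)
    (t : ℝ≥0) (A : FinLowerSet Λ) :
    HasSum (transProb rate t A) ((weightLaw rate).real {z | growFrom A z t ≠ none}) := by
  have := hΛ.countable
  have := FinLowerSet.countable (Λ := Λ)
  have := isProbabilityMeasure_weightLaw hrate
  have h := hasSum_measureReal_inter_state (μ := weightLaw rate) (f := fun z => growFrom A z t)
    (fun b => measurableSet_growFrom_eq A t (some b)) MeasurableSet.univ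
  simp only [Set.univ_inter] at h
  exact h

theorem growFrom_ne_none_of_le {A : FinLowerSet Λ} {g : Λ → ℝ} {s t : ℝ≥0} (hst : s ≤ t)
    (h : growFrom A g t ≠ none) : growFrom A g s ≠ none :=
  growthState_ne_none.2 ((growthState_ne_none.1 h).subset (grownSet_mono _ hst))

theorem isTransitionFunction_transProb (hΛ : IsLocallyFinitePoset Λ) {rate : Λ → ℝ}
    (hrate : ∀ α, 0 < rate α) : IsTransitionFunction (transProb rate) := by
  have := hΛ.countable
  have := FinLowerSet.countable (Λ := Λ)
  have := isProbabilityMeasure_weightLaw hrate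
  have hself : ∀ᵐ z ∂weightLaw rate, ∀ A, growFrom A z 0 = some A := by
    filter_upwards [ae_weightLaw_pos hrate] with z hz A
    exact (growFrom_eq_self_iff A z 0).2 fun α _ => hz α
  refine ⟨fun t A B => measureReal_nonneg, fun t A => (hasSum_transProb hΛ hrate t A).summable,
    fun t A => ?_, fun A => ?_, fun A B hAB => ?_, fun s t A B => ?_⟩
  · rw [(hasSum_transProb hΛ hrate t A).tsum_eq]
    exact measureReal_le_one
  · have h : {z | growFrom A z 0 = some A} =ᵐ[weightLaw rate] Set.univ := by
      filter_upwards [hself] with z hz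
      exact eq_true (hz A)
    rw [transProb, measureReal_congr h, probReal_univ]
  · have h : {z | growFrom A z 0 = some B} =ᵐ[weightLaw rate] (∅ : Set (Λ → ℝ)) := by
      filter_upwards [hself] with z hz
      exact eq_false fun h => hAB (Option.some.inj ((hz A).symm.trans h))
    rw [transProb, measureReal_congr h, measureReal_empty]
  · have h := hasSum_measureReal_inter_state (μ := weightLaw rate) (f := fun z => growFrom A z s)
      (fun b => measurableSet_growFrom_eq A s (some b))
      (measurableSet_growFrom_eq A (s + t) (some B))
    -- A state that is finite at time `s + t` was finite at time `s`, so summing over the states at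
    -- time `s` loses no mass.
    have hF : {z | growFrom A z (s + t) = some B} ∩ {z | growFrom A z s ≠ none} =
        {z | growFrom A z (s + t) = some B} := by
      refine Set.inter_eq_left.2 fun z hz => ?_
      rw [Set.mem_ofPred_eq] at hz
      exact growFrom_ne_none_of_le (t := s + t) le_self_add (by simp [hz])
    rw [hF] at h
    rw [transProb, ← h.tsum_eq]
    refine tsum_congr fun C => ?_
    have hm := growFrom_markov hΛ hrate A C B s t MeasurableSet.univ
    simp only [Set.mem_univ, true_and] at hm
    rw [transProb, transProb, measureReal_def, measureReal_def, measureReal_def,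
      ← ENNReal.toReal_mul, ← hm]
    congr 2
    ext z
    exact and_comm

theorem hasGenerator_transProb (hΛ : IsLocallyFinitePoset Λ) {rate : Λ → ℝ}
    (hrate : ∀ α, 0 < rate α) : HasGenerator (transProb rate) (growthGenerator rate) := by
  classical
  have := hΛ.countable
  have := isProbabilityMeasure_weightLaw hrate
  have hp := isTransitionFunction_transProb hΛ hrate
  rintro f ⟨C, hC⟩ A
  have hC0 : 0 ≤ C := (abs_nonneg _).trans (hC A)
  have := (finite_growthElements hΛ A).fintype
  set K : growthElements A → Finset Λ :=
    fun α => (finite_growthElements hΛ (grow A α)).toFinset with hK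
  -- Lower bounds for the transition probabilities: `none` stands for staying in `A`, and `some α`
  -- for adding `α` only.
  set l : ℝ≥0 → Option (growthElements A) → ℝ := fun h o =>
    o.elim (Real.exp (-((∑ α : growthElements A, rate α.1) * h))) fun α =>
      (1 - Real.exp (-(rate α.1 * h))) * Real.exp (-((∑ β ∈ K α, rate β) * h)) with hl
  set c : Option (growthElements A) → FinLowerSet Λ := fun o => o.elim A (grow A) with hc
  have hle : ∀ h o, l h o ≤ transProb rate h A (c o) := by
    rintro h (_ | α)
    · have h1 := weightLaw_real_forall_lt hrate (finite_growthElements hΛ A).toFinset h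
      refine le_of_eq ?_
      simp only [hl, hc, Option.elim]
      rw [transProb]
      simp only [growFrom_eq_self_iff]
      simp only [Set.Finite.mem_toFinset] at h1
      rw [h1]
      rw [Finset.sum_subtype (finite_growthElements hΛ A).toFinset
        (p := fun x => x ∈ growthElements A) (fun x => Set.Finite.mem_toFinset _) rate]
    · have hα : α.1 ∉ K α := by
        simp only [hK, Set.Finite.mem_toFinset]
        exact fun h' => h'.1 (Set.mem_insert α.1 A.1)
      simp only [hl, hc, Option.elim]
      rw [← weightLaw_real_le_and_forall_lt hrate hα h, transProb]
      refine measureReal_mono fun z hz => ?_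
      exact growFrom_eq_grow A α hz.1 fun β hβ => hz.2 β (by simpa [hK] using hβ)
  have hmain : ∀ φ : FinLowerSet Λ → ℝ, Tendsto
      (fun h : ℝ≥0 => (∑ o, l h o * φ (c o) - φ A) / (h : ℝ)) (𝓝[>] 0)
      (𝓝 (∑ α : growthElements A, rate α.1 * (φ (grow A α) - φ A))) := by
    intro φ
    have h := tendsto_exp_slope (fun α : growthElements A => rate α.1)
      (fun α => ∑ β ∈ K α, rate β) (fun α => φ (grow A α)) (φ A)
    refine h.congr fun h => ?_
    rw [Fintype.sum_option]
    rfl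
  have hgen : growthGenerator rate f A =
      ∑ α : growthElements A, rate α.1 * (f (grow A α) - f A) :=
    finsum_eq_sum_of_fintype _
  rw [hgen]
  -- For the constant function `1` the limit is `0`, so the mass missed by the lower bounds is
  -- `o(h)`. The factor `-C` turns this into the error bound for `f`.
  have hone := (hmain fun _ => 1).const_mul (-C)
  simp only [sub_self, mul_zero, Finset.sum_const_zero, mul_one] at hone
  refine tendsto_of_tendsto_of_dist (hmain f) ?_
  refine squeeze_zero (fun _ => dist_nonneg) (fun h => ?_) hone
  rw [dist_comm, Real.dist_eq, ← sub_div, abs_div, abs_of_nonneg h.coe_nonneg, mul_div_assoc']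
  refine div_le_div_of_nonneg_right ?_ h.coe_nonneg
  have h2 := abs_tsum_sub_sum_le (hp.nonneg h A) (hp.summable h A) (hp.tsum_le_one h A) hC0 hC
    (grow_injective A) (hle h)
  rw [sub_sub_sub_cancel_right]
  refine h2.trans (le_of_eq ?_)
  ring

end Transition

/-! ### The last passage percolation process is a Markov jump process -/

theorem map_eq_weightLaw {Λ Ω : Type*} [MeasurableSpace Ω] {μ : Measure Ω} {G : Λ → Ω → ℝ}
    {rate : Λ → ℝ} (hGmeas : ∀ α, Measurable (G α))
    (hGlaw : ∀ α, μ.map (G α) = expMeasure (rate α)) (hGindep : iIndepFun G μ) :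
    μ.map (fun ω α => G α ω) = weightLaw rate := by
  rw [hGindep.map_fun_eq_infinitePi_map hGmeas, weightLaw]
  simp only [hGlaw]

theorem ae_forall_pos {Λ Ω : Type*} [PartialOrder Λ] [MeasurableSpace Ω] {μ : Measure Ω}
    {G : Λ → Ω → ℝ} {rate : Λ → ℝ} (hΛ : IsLocallyFinitePoset Λ) (hrate : ∀ α, 0 < rate α)
    (hGmeas : ∀ α, Measurable (G α))
    (hGlaw : ∀ α, μ.map (G α) = expMeasure (rate α)) (hGindep : iIndepFun G μ) :
    ∀ᵐ ω ∂μ, ∀ α, 0 < G α ω := by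
  have := hΛ.countable
  have h := ae_weightLaw_pos hrate
  rw [← map_eq_weightLaw hGmeas hGlaw hGindep] at h
  exact ae_of_ae_map (measurable_pi_iff.2 hGmeas).aemeasurable h

section Percolation

variable {Λ : Type*} [PartialOrder Λ]

theorem measurable_passageValue (A : FinLowerSet Λ) :
    Measurable fun g : Λ → ℝ => passageValue g A := by
  have hsum : ∀ π : List Λ, Measurable fun g : Λ → ℝ => (π.map g).sum := by
    intro π
    induction π with
    | nil => simp
    | cons a l ih =>
      simp only [List.map_cons, List.sum_cons]
      exact (measurable_pi_apply a).add ih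
  refine measurable_of_Iic fun x => ?_
  have hset : (fun g : Λ → ℝ => passageValue g A) ⁻¹' Set.Iic x =
      ⋂ π ∈ maxPaths A, {g : Λ → ℝ | (π.map g).sum ≤ x} := by
    ext g
    simp only [Set.mem_preimage, Set.mem_Iic, Set.mem_iInter, Set.mem_ofPred_eq]
    constructor
    · exact fun h π hπ => ((isGreatest_passageValue g A).2 (Set.mem_image_of_mem _ hπ)).trans h
    · intro h
      obtain ⟨π, hπ, heq⟩ := (isGreatest_passageValue g A).1
      exact heq ▸ h π hπ
  rw [hset]
  exact ((paths_finite A).subset fun π h => h.1).measurableSet_biInter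
    fun π _ => measurableSet_le (hsum π) measurable_const

theorem measurable_lppState [Countable Λ] (t : ℝ≥0) :
    Measurable fun g : Λ → ℝ => lppState g t := by
  have := FinLowerSet.countable (Λ := Λ)
  have hmem : ∀ β, MeasurableSet {g : Λ → ℝ | β ∈ lppSet g t} := by
    intro β
    have : {g : Λ → ℝ | β ∈ lppSet g t} =
        ⋃ A : FinLowerSet Λ, {g | passageValue g A ≤ t ∧ β ∈ A.1} := by
      ext g
      simp [lppSet]
    rw [this]
    exact MeasurableSet.iUnion fun A =>
      (measurableSet_le (measurable_passageValue A) measurable_const).inter (MeasurableSet.const _)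
  have hsome : ∀ B, MeasurableSet {g : Λ → ℝ | lppState g t = some B} := by
    intro B
    have : {g : Λ → ℝ | lppState g t = some B} = ⋂ β, {g | β ∈ lppSet g t ↔ β ∈ B.1} := by
      ext g
      simp only [Set.mem_ofPred_eq, lppState_eq_some, Set.mem_iInter, Set.ext_iff]
    rw [this]
    exact MeasurableSet.iInter fun β => MeasurableSet.iff (hmem β) (MeasurableSet.const _)
  refine measurable_to_countable' fun o => ?_
  cases o with
  | some B => exact hsome B
  | none =>
    have : (fun g : Λ → ℝ => lppState g t) ⁻¹' {none} =
        (⋃ B, {g : Λ → ℝ | lppState g t = some B})ᶜ := by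
      ext g
      simp only [Set.mem_preimage, Set.mem_singleton_iff, Set.mem_compl_iff, Set.mem_iUnion,
        Set.mem_ofPred_eq, not_exists]
      exact Option.eq_none_iff_forall_ne_some
    rw [this]
    exact (MeasurableSet.iUnion hsome).compl

theorem growFrom_emptyLower [WellFoundedLT Λ] (hΛ : IsLocallyFinitePoset Λ) {g : Λ → ℝ}
    (hg : ∀ α, 0 ≤ g α) (t : ℝ≥0) : growFrom emptyLower g t = lppState g t := by
  rw [lppState_eq_growthState hΛ hg, growFrom]
  congr 1
  funext β
  exact startWeights_of_notMem (Set.notMem_empty β) g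

variable {Ω : Type*} [MeasurableSpace Ω] {μ : Measure Ω}
  {G : Λ → Ω → ℝ} {rate : Λ → ℝ}

theorem isMarkovJumpProcess_lppState (hΛ : IsLocallyFinitePoset Λ) (hrate : ∀ α, 0 < rate α)
    (hGmeas : ∀ α, Measurable (G α))
    (hGlaw : ∀ α, μ.map (G α) = expMeasure (rate α)) (hGindep : iIndepFun G μ) :
    IsMarkovJumpProcess μ (fun t ω => lppState (fun α => G α ω) t) emptyLower
      (growthGenerator rate) := by
  have := hΛ.countable
  have := hΛ.wellFoundedLT
  have hG : Measurable fun ω α => G α ω := measurable_pi_iff.2 hGmeas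
  have hlaw := map_eq_weightLaw hGmeas hGlaw hGindep
  have hpos := ae_forall_pos hΛ hrate hGmeas hGlaw hGindep
  refine ⟨fun t S => (measurable_lppState t).comp hG (MeasurableSet.of_discrete (s := S)), ?_, ?_,
    transProb rate, isTransitionFunction_transProb hΛ hrate, hasGenerator_transProb hΛ hrate, ?_⟩
  · filter_upwards [hpos] with ω hω
    rw [← growFrom_emptyLower hΛ fun α => (hω α).le]
    exact (growFrom_eq_self_iff _ _ 0).2 fun α _ => hω α
  · filter_upwards [hpos] with ω hω
    have h := isJumpPath_growthState hΛ fun α => ENNReal.ofReal (G α ω)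
    convert h using 2 with t
    exact lppState_eq_growthState hΛ (fun α => (hω α).le) t
  · intro s h F hF A B
    obtain ⟨S, hS, rfl⟩ := exists_preimage_of_measurableSet_history hF
    have hS' : MeasurableSet S := hS
    -- The identity is moved to the space of weights. The descriptions of the process need agree
    -- only for positive weights, which occur almost surely.
    have key : ∀ T : Set (Λ → ℝ), MeasurableSet T → ∀ U : Set Ω,
        (∀ ω, (∀ α, 0 < G α ω) → (ω ∈ U ↔ (fun α => G α ω) ∈ T)) →
        μ.real U = (weightLaw rate).real T := by
      intro T hT U hU
      rw [← hlaw, map_measureReal_apply hG hT]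
      refine measureReal_congr ?_
      filter_upwards [hpos] with ω hω
      exact propext (hU ω hω)
    have hpast : MeasurableSet {z | (fun r : Set.Iic s => growFrom emptyLower z r.1) ∈ S} :=
      (measurable_pi_iff.2 fun r : Set.Iic s => measurable_growFrom emptyLower r.1) hS'
    have hm := congrArg ENNReal.toReal (growFrom_markov hΛ hrate emptyLower A B s h hS')
    rw [ENNReal.toReal_mul] at hm
    have hproc : ∀ ω, (∀ α, 0 < G α ω) → ∀ t,
        growFrom emptyLower (fun α => G α ω) t = lppState (fun α => G α ω) t :=
      fun ω hω t => growFrom_emptyLower hΛ (fun α => (hω α).le) t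
    rw [transProb, key _ (hpast.inter ((measurableSet_growFrom_eq emptyLower s (some A)).inter
        (measurableSet_growFrom_eq emptyLower (s + h) (some B)))),
      key _ (hpast.inter (measurableSet_growFrom_eq emptyLower s (some A)))]
    · exact hm
    · intro ω hω
      simp only [Set.mem_inter_iff, Set.mem_preimage, Set.mem_ofPred_eq, hproc ω hω]
    · intro ω hω
      simp only [Set.mem_inter_iff, Set.mem_preimage, Set.mem_ofPred_eq, hproc ω hω, and_assoc]

end Percolation

/-! ### Uniqueness of transition functions -/

section Transition

variable {E : Type*} {p p' : ℝ≥0 → E → E → ℝ}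

open Classical in
theorem HasGenerator.tendsto_div {gen : (E → ℝ) → E → ℝ} (hp : HasGenerator p gen) (a b : E) :
    Tendsto (fun h : ℝ≥0 => (p h a b - if a = b then 1 else 0) / (h : ℝ)) (𝓝[>] 0)
      (𝓝 (gen (fun c => if c = b then 1 else 0) a)) := by
  have h := hp (fun c => if c = b then 1 else 0)
    ⟨1, fun c => by split_ifs <;> simp⟩ a
  refine h.congr fun t => ?_
  rw [tsum_eq_single b]
  · simp
  · intro c hc
    simp [hc]

theorem IsTransitionFunction.le_one (hp : IsTransitionFunction p) (t : ℝ≥0) (a b : E) :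
    p t a b ≤ 1 :=
  ((hp.summable t a).le_tsum b fun c _ => hp.nonneg t a c).trans (hp.tsum_le_one t a)

theorem IsTransitionFunction.chapman_kolmogorov_finset (hp : IsTransitionFunction p) {b : E}
    {S : Finset E} (hS : ∀ t c, c ∉ S → p t c b = 0) (s t : ℝ≥0) (a : E) :
    p (s + t) a b = ∑ c ∈ S, p s a c * p t c b := by
  rw [hp.chapman_kolmogorov, tsum_eq_sum]
  intro c hc
  rw [hS t c hc, mul_zero]

/-- The `n`-step error is at most `n` times the one-step error: row sums and entries are at most
`1`, so replacing one factor at a time never amplifies earlier errors. -/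
theorem abs_transition_sub_le (hp : IsTransitionFunction p) (hp' : IsTransitionFunction p')
    {b : E} {S : Finset E} (hS : ∀ t c, c ∉ S → p t c b = 0) (hS' : ∀ t c, c ∉ S → p' t c b = 0)
    (h : ℝ≥0) (n : ℕ) (a : E) :
    |p (n * h) a b - p' (n * h) a b| ≤ n * ∑ d ∈ S, ∑ c ∈ S, |p h d c - p' h d c| := by
  set ε := ∑ d ∈ S, ∑ c ∈ S, |p h d c - p' h d c| with hε
  have hε0 : 0 ≤ ε := Finset.sum_nonneg fun d _ => Finset.sum_nonneg fun c _ => abs_nonneg _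
  induction n generalizing a with
  | zero =>
    by_cases hab : a = b
    · subst hab
      simp [hp.zero_self, hp'.zero_self]
    · simp [hp.zero_ne a b hab, hp'.zero_ne a b hab]
  | succ n ih =>
    by_cases ha : a ∈ S
    swap
    · rw [hS _ a ha, hS' _ a ha, sub_self, abs_zero]
      positivity
    have hstep : ((n + 1 : ℕ) : ℝ≥0) * h = h + n * h := by
      push_cast
      ring
    rw [hstep, hp.chapman_kolmogorov_finset hS, hp'.chapman_kolmogorov_finset hS',
      ← Finset.sum_sub_distrib]
    have hterm : ∀ c ∈ S, |p h a c * p (n * h) c b - p' h a c * p' (n * h) c b| ≤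
        p h a c * (n * ε) + |p h a c - p' h a c| := by
      intro c _
      have h1 : p h a c * p (n * h) c b - p' h a c * p' (n * h) c b =
          p h a c * (p (n * h) c b - p' (n * h) c b) +
            (p h a c - p' h a c) * p' (n * h) c b := by ring
      rw [h1]
      refine (abs_add_le _ _).trans (add_le_add ?_ ?_)
      · rw [abs_mul, abs_of_nonneg (hp.nonneg h a c)]
        exact mul_le_mul_of_nonneg_left (ih c) (hp.nonneg h a c)
      · rw [abs_mul, abs_of_nonneg (hp'.nonneg _ c b)]
        exact mul_le_of_le_one_right (abs_nonneg _) (hp'.le_one _ c b)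
    refine (Finset.abs_sum_le_sum_abs _ _).trans ((Finset.sum_le_sum hterm).trans ?_)
    rw [Finset.sum_add_distrib, ← Finset.sum_mul]
    have h2 : ∑ c ∈ S, p h a c ≤ 1 :=
      ((hp.summable h a).sum_le_tsum S fun c _ => hp.nonneg h a c).trans (hp.tsum_le_one h a)
    have h3 : ∑ c ∈ S, |p h a c - p' h a c| ≤ ε :=
      Finset.single_le_sum (f := fun d => ∑ c ∈ S, |p h d c - p' h d c|)
        (fun d _ => Finset.sum_nonneg fun c _ => abs_nonneg _) ha
    have h4 : (∑ c ∈ S, p h a c) * (n * ε) ≤ n * ε :=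
      mul_le_of_le_one_left (by positivity) h2
    push_cast
    linarith

theorem tendsto_div_succ {t : ℝ≥0} (ht : 0 < t) :
    Tendsto (fun n : ℕ => t / ((n + 1 : ℕ) : ℝ≥0)) atTop (𝓝[>] 0) := by
  refine tendsto_nhdsWithin_iff.2 ⟨?_, Eventually.of_forall fun n => ?_⟩
  · have h : Tendsto (fun n : ℕ => t / (n : ℝ≥0)) atTop (𝓝 0) := by
      rw [← NNReal.tendsto_coe]
      push_cast
      exact tendsto_const_div_atTop_nhds_zero_nat (t : ℝ)
    exact h.comp (tendsto_add_atTop_nat 1)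
  · exact div_pos ht (by positivity)

/-- Two transition functions with the same generator, for which each state can be reached
from finitely many states only, agree. -/
theorem transition_unique (hp : IsTransitionFunction p) (hp' : IsTransitionFunction p')
    {gen : (E → ℝ) → E → ℝ} (hg : HasGenerator p gen) (hg' : HasGenerator p' gen) {b : E}
    {S : Finset E} (hS : ∀ t c, c ∉ S → p t c b = 0) (hS' : ∀ t c, c ∉ S → p' t c b = 0)
    (t : ℝ≥0) (a : E) : p t a b = p' t a b := by
  classical
  rcases eq_or_ne t 0 with rfl | ht
  · by_cases hab : a = b
    · subst hab
      rw [hp.zero_self, hp'.zero_self]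
    · rw [hp.zero_ne a b hab, hp'.zero_ne a b hab]
  have ht : 0 < t := pos_iff_ne_zero.2 ht
  -- Both functions have the same derivative at `0`, so each of the finitely many entries differs by
  -- `o(h)`. With `n + 1` steps of length `t / (n + 1)` the total error tends to `0`.
  have hlim : Tendsto (fun h : ℝ≥0 => (∑ d ∈ S, ∑ c ∈ S, |p h d c - p' h d c|) / (h : ℝ))
      (𝓝[>] 0) (𝓝 0) := by
    have h : Tendsto (fun h : ℝ≥0 => ∑ d ∈ S, ∑ c ∈ S, |(p h d c - p' h d c) / (h : ℝ)|)
        (𝓝[>] 0) (𝓝 (∑ d ∈ S, ∑ c ∈ S, 0)) := by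
      refine tendsto_finsetSum _ fun d _ => tendsto_finsetSum _ fun c _ => ?_
      have h1 := ((hg.tendsto_div d c).sub (hg'.tendsto_div d c)).abs
      rw [sub_self, abs_zero] at h1
      refine h1.congr fun h => ?_
      rw [← sub_div, sub_sub_sub_cancel_right]
    simp only [Finset.sum_const_zero] at h
    refine h.congr fun h => ?_
    simp only [Finset.sum_div, abs_div, abs_of_nonneg h.coe_nonneg]
  have hlim' := (hlim.comp (tendsto_div_succ ht)).const_mul (t : ℝ)
  rw [mul_zero] at hlim'
  have hle : |p t a b - p' t a b| ≤ 0 := by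
    refine ge_of_tendsto hlim' (Eventually.of_forall fun n => ?_)
    have h := abs_transition_sub_le hp hp' hS hS' (t / ((n + 1 : ℕ) : ℝ≥0)) (n + 1) a
    have hn : (((n + 1 : ℕ) : ℝ≥0)) ≠ 0 := by positivity
    rw [mul_div_cancel₀ t hn] at h
    refine h.trans (le_of_eq ?_)
    have hn' : (((n + 1 : ℕ) : ℝ)) ≠ 0 := by positivity
    have ht' : (t : ℝ) ≠ 0 := (NNReal.coe_pos.2 ht).ne'
    simp only [Function.comp_apply, NNReal.coe_div, NNReal.coe_natCast]
    field_simp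
  exact sub_eq_zero.1 (abs_eq_zero.1 (le_antisymm hle (abs_nonneg _)))

end Transition

/-! ### Paths of jump processes -/

section Paths

variable {E : Type*}

/-- A jump path whose jumps all respect a preorder `R` is monotone. -/
theorem IsJumpPath.rel_of_le {x : ℝ≥0 → Option E} (hx : IsJumpPath x) {R : E → E → Prop}
    (hrefl : ∀ a, R a a) (htrans : ∀ a b c, R a b → R b c → R a c)
    (hjump : ∀ u, 0 < u → ∀ a b, (∀ᶠ v in 𝓝[<] u, x v = some a) → x u = some b → R a b)
    {s t : ℝ≥0} (hst : s ≤ t) {a b : E} (ha : x s = some a) (hb : x t = some b) : R a b := by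
  -- Continuous induction: within `[s, t]` this set of times is closed, by left limits and `hjump`,
  -- and it extends to the right of each of its points by right-continuity.
  set S : Set ℝ≥0 := {v | ∃ c, x v = some c ∧ R a c} with hS
  have hclosed : IsClosed (S ∩ Set.Icc s t) := by
    refine isClosed_of_closure_subset fun v hv => ?_
    have hvI : v ∈ Set.Icc s t :=
      closure_minimal Set.inter_subset_right isClosed_Icc hv
    refine ⟨?_, hvI⟩
    by_contra hvS
    have hvn : x v ≠ none := fun h => by
      have := hx.absorbed v t hvI.2 h
      simp [hb] at this
    obtain ⟨d, hd⟩ := Option.ne_none_iff_exists'.1 hvn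
    have had : ¬ R a d := fun h => hvS ⟨d, hd, h⟩
    have hev : ∀ᶠ w in 𝓝 v, w ∉ S := by
      rw [← nhdsLT_sup_nhdsGE, Filter.eventually_sup]
      constructor
      · rcases eq_or_ne v 0 with rfl | hv0
        · simp
        · obtain ⟨c, hc⟩ := hx.left_lim v hvn
          filter_upwards [hc] with w hw
          rintro ⟨c', hc', hac⟩
          obtain rfl : c = c' := Option.some.inj (hw.symm.trans hc')
          exact had (htrans _ _ _ hac (hjump v (pos_iff_ne_zero.2 hv0) c d hc hd))
      · rw [← Set.Ioi_insert, nhdsWithin_insert, Filter.eventually_sup]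
        refine ⟨hvS, ?_⟩
        filter_upwards [hx.right_cont v d hd] with w hw
        rintro ⟨c', hc', hac⟩
        obtain rfl : d = c' := Option.some.inj (hw.symm.trans hc')
        exact had hac
    exact (mem_closure_iff_frequently.1 hv) (hev.mono fun w hw hw' => hw hw'.1)
  have hsub : Set.Icc s t ⊆ S := by
    refine hclosed.Icc_subset_of_forall_mem_nhdsWithin ⟨a, ha, hrefl a⟩ ?_
    rintro v ⟨⟨c, hc, hac⟩, -⟩
    filter_upwards [hx.right_cont v c hc] with w hw
    exact ⟨c, hw, hac⟩
  obtain ⟨c, hc, hac⟩ := hsub ⟨hst, le_rfl⟩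
  obtain rfl : c = b := Option.some.inj (hc.symm.trans hb)
  exact hac

/-- If a jump path jumps from `a` to `b` before time `N` then this is seen on all sufficiently
fine grids. -/
theorem IsJumpPath.eventually_exists_grid {x : ℝ≥0 → Option E} (hx : IsJumpPath x) {u : ℝ≥0}
    (hu : 0 < u) {N : ℕ} (huN : u ≤ N) {a b : E} (ha : ∀ᶠ v in 𝓝[<] u, x v = some a)
    (hb : x u = some b) :
    ∀ᶠ n : ℕ in atTop, ∃ k < N * (n + 1), x (k * (1 / ((n + 1 : ℕ) : ℝ≥0))) = some a ∧
      x (k * (1 / ((n + 1 : ℕ) : ℝ≥0)) + 1 / ((n + 1 : ℕ) : ℝ≥0)) = some b := by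
  obtain ⟨l, hl, hla⟩ := (mem_nhdsLT_iff_exists_Ioo_subset' hu).1 ha
  obtain ⟨r, hr, hrb⟩ := mem_nhdsGT_iff_exists_Ioo_subset.1 (hx.right_cont u b hb)
  have hl : l < u := hl
  have hr : u < r := hr
  have hδ : Tendsto (fun n : ℕ => 1 / ((n + 1 : ℕ) : ℝ≥0)) atTop (𝓝 0) :=
    (tendsto_div_succ one_pos).mono_right nhdsWithin_le_nhds
  filter_upwards [hδ.eventually_lt_const (tsub_pos_of_lt hl),
    hδ.eventually_lt_const (tsub_pos_of_lt hr)] with n h1 h2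
  set m : ℝ≥0 := ((n + 1 : ℕ) : ℝ≥0) with hm
  have hm0 : 0 < m := by positivity
  have hc0 : 0 < ⌈u * m⌉₊ := Nat.ceil_pos.2 (mul_pos hu hm0)
  -- The grid cell with `k / m < u ≤ (k + 1) / m`. Once the mesh is small its left end lies where
  -- the path is `a` and its right end where it is `b`.
  obtain ⟨k, hk⟩ : ∃ k, ⌈u * m⌉₊ = k + 1 := ⟨⌈u * m⌉₊ - 1, by omega⟩
  have hk1 : (k : ℝ≥0) < u * m := Nat.lt_ceil.1 (by omega)
  have hk2 : u * m ≤ k + 1 := by exact_mod_cast Nat.ceil_le.1 hk.le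
  have hkm : (k : ℝ≥0) * (1 / m) < u := by rwa [mul_one_div, div_lt_iff₀ hm0]
  have hkm' : u ≤ k * (1 / m) + 1 / m := by
    rwa [← add_one_mul, mul_one_div, le_div_iff₀ hm0]
  refine ⟨k, ?_, ?_, ?_⟩
  · have h3 : ⌈u * m⌉₊ ≤ N * (n + 1) := by
      refine Nat.ceil_le.2 ?_
      push_cast [hm]
      gcongr
    omega
  · refine hla ⟨?_, hkm⟩
    have h4 : u < k * (1 / m) + (u - l) := hkm'.trans_lt (by gcongr)
    have h5 : l + (u - l) = u := add_tsub_cancel_of_le hl.le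
    nth_rewrite 1 [← h5] at h4
    exact lt_of_add_lt_add_right h4
  · rcases hkm'.eq_or_lt with h | h
    · rw [← h]
      exact hb
    · refine hrb ⟨h, ?_⟩
      calc k * (1 / m) + 1 / m < u + (r - u) := add_lt_add hkm h2
        _ = r := add_tsub_cancel_of_le hr.le

end Paths

/-! ### The law of a Markov jump process -/

/-- The Markov property of `X` with transition function `p`. -/
def HasTransition {E Ω : Type*} [MeasurableSpace Ω] (μ : Measure Ω) (X : ℝ≥0 → Ω → Option E)
    (p : ℝ≥0 → E → E → ℝ) : Prop :=
  ∀ (s h : ℝ≥0) (F : Set Ω), MeasurableSet[history X s] F → ∀ a b : E,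
    μ.real (F ∩ {ω | X s ω = some a} ∩ {ω | X (s + h) ω = some b}) =
      μ.real (F ∩ {ω | X s ω = some a}) * p h a b

section Law

variable {E Ω : Type*} [MeasurableSpace Ω] {μ : Measure Ω} {X : ℝ≥0 → Ω → Option E}
  {p : ℝ≥0 → E → E → ℝ}

theorem HasTransition.apply_univ (hX : HasTransition μ X p) (s h : ℝ≥0) (a b : E) :
    μ.real {ω | X s ω = some a ∧ X (s + h) ω = some b} =
      μ.real {ω | X s ω = some a} * p h a b := by
  have h1 := hX s h Set.univ MeasurableSet.univ a b
  rw [Set.univ_inter] at h1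
  exact h1

/-- Peels off the latest time, which computes all finite-dimensional probabilities by induction. -/
theorem HasTransition.real_insert (hX : HasTransition μ X p) {s : ℝ≥0} {I : Finset ℝ≥0}
    (hs : s ∈ I) (hI : ∀ r ∈ I, r ≤ s) {t : ℝ≥0} (hst : s ≤ t) (a : ℝ≥0 → E) :
    μ.real {ω | ∀ r ∈ insert t I, X r ω = some (a r)} =
      μ.real {ω | ∀ r ∈ I, X r ω = some (a r)} * p (t - s) (a s) (a t) := by
  have hF : MeasurableSet[history X s] {ω | ∀ r ∈ I, X r ω = some (a r)} := by
    have : {ω | ∀ r ∈ I, X r ω = some (a r)} = ⋂ r ∈ I, X r ⁻¹' {some (a r)} := by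
      ext ω
      simp
    rw [this]
    refine @Finset.measurableSet_biInter _ _ (history X s) _ I fun r hr => ?_
    have hle : MeasurableSpace.comap (X r) ⊤ ≤ history X s :=
      le_iSup₂_of_le r (hI r hr) le_rfl
    exact hle _ ⟨{some (a r)}, MeasurableSpace.measurableSet_top, rfl⟩
  have h := hX s (t - s) _ hF (a s) (a t)
  have h1 : {ω | ∀ r ∈ I, X r ω = some (a r)} ∩ {ω | X s ω = some (a s)} =
      {ω | ∀ r ∈ I, X r ω = some (a r)} := Set.inter_eq_left.2 fun ω hω => hω s hs
  rw [h1, add_tsub_cancel_of_le hst] at h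
  rw [← h]
  congr 1
  ext ω
  simp [and_comm]

theorem HasTransition.real_single [IsProbabilityMeasure μ] {x₀ : E} (hX : HasTransition μ X p)
    (h0 : ∀ᵐ ω ∂μ, X 0 ω = some x₀) (t : ℝ≥0) (a : E) :
    μ.real {ω | X t ω = some a} = p t x₀ a := by
  have h := hX.apply_univ 0 t x₀ a
  rw [zero_add] at h
  have e1 : {ω | X 0 ω = some x₀} =ᵐ[μ] Set.univ := by
    filter_upwards [h0] with ω hω
    exact eq_true hω
  have e2 : {ω | X 0 ω = some x₀ ∧ X t ω = some a} =ᵐ[μ] {ω | X t ω = some a} := by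
    filter_upwards [h0] with ω hω
    exact propext (and_iff_right hω)
  rw [measureReal_congr e1, measureReal_congr e2, probReal_univ, one_mul] at h
  exact h

variable {Ω' : Type*} [MeasurableSpace Ω'] {P : Measure Ω'} {X' : ℝ≥0 → Ω' → Option E}

theorem HasTransition.cylinder_eq [IsProbabilityMeasure μ] [IsProbabilityMeasure P] {x₀ : E}
    (hX : HasTransition μ X p) (hX' : HasTransition P X' p)
    (h0 : ∀ᵐ ω ∂μ, X 0 ω = some x₀) (h0' : ∀ᵐ ω ∂P, X' 0 ω = some x₀)
    (I : Finset ℝ≥0) (a : ℝ≥0 → E) :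
    μ.real {ω | ∀ r ∈ I, X r ω = some (a r)} = P.real {ω | ∀ r ∈ I, X' r ω = some (a r)} := by
  induction I using Finset.induction_on_max with
  | empty => simp
  | insert t I hI ih =>
    rcases I.eq_empty_or_nonempty with rfl | hne
    · simp only [insert_empty_eq, Finset.mem_singleton, forall_eq]
      rw [hX.real_single h0, hX'.real_single h0']
    · have hs := I.max'_mem hne
      have hle : ∀ r ∈ I, r ≤ I.max' hne := fun r hr => I.le_max' r hr
      rw [hX.real_insert hs hle (hI _ hs).le, hX'.real_insert hs hle (hI _ hs).le, ih]

/-- Finite-dimensional cylinders that specify non-cemetery values. -/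
def stateCylinders (E : Type*) : Set (Set (ℝ≥0 → Option E)) :=
  {S | ∃ (I : Finset ℝ≥0) (a : ℝ≥0 → E), S = {x | ∀ r ∈ I, x r = some (a r)}}

theorem isPiSystem_stateCylinders : IsPiSystem (stateCylinders E) := by
  classical
  rintro _ ⟨I, a, rfl⟩ _ ⟨J, b, rfl⟩ ⟨x, hx, hx'⟩
  refine ⟨I ∪ J, fun r => if r ∈ I then a r else b r, ?_⟩
  have hab : ∀ r ∈ I, r ∈ J → a r = b r := fun r hr hr' =>
    Option.some.inj ((hx r hr).symm.trans (hx' r hr'))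
  ext y
  simp only [Set.mem_inter_iff, Set.mem_ofPred_eq, Finset.mem_union]
  constructor
  · rintro ⟨h1, h2⟩ r hr
    by_cases hI : r ∈ I
    · rw [if_pos hI, h1 r hI]
    · rw [if_neg hI, h2 r (hr.resolve_left hI)]
  · intro h
    refine ⟨fun r hr => ?_, fun r hr => ?_⟩
    · rw [h r (Or.inl hr), if_pos hr]
    · rw [h r (Or.inr hr)]
      split_ifs with hI
      · rw [hab r hI hr]
      · rfl

/-- The Markov property controls values in `E` only. This is enough, because being in the cemetery
is the complement of a countable union of such events. -/
theorem generateFrom_stateCylinders [Nonempty E] [Countable E] [MeasurableSpace (Option E)]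
    [DiscreteMeasurableSpace (Option E)] :
    (MeasurableSpace.pi : MeasurableSpace (ℝ≥0 → Option E)) =
      MeasurableSpace.generateFrom (stateCylinders E) := by
  refine le_antisymm (iSup_le fun t => ?_) (MeasurableSpace.generateFrom_le ?_)
  · rw [← measurable_iff_comap_le]
    have hsome : ∀ a : E, MeasurableSet[MeasurableSpace.generateFrom (stateCylinders E)]
        {x : ℝ≥0 → Option E | x t = some a} := fun a =>
      MeasurableSpace.measurableSet_generateFrom ⟨{t}, fun _ => a, by simp⟩
    refine @measurable_to_countable' _ _ _ _ (MeasurableSpace.generateFrom _) _ fun o => ?_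
    cases o with
    | some a => exact hsome a
    | none =>
      have : (fun x : ℝ≥0 → Option E => x t) ⁻¹' {none} =
          (⋃ a, {x : ℝ≥0 → Option E | x t = some a})ᶜ := by
        ext x
        simp only [Set.mem_preimage, Set.mem_singleton_iff, Set.mem_compl_iff, Set.mem_iUnion,
          Set.mem_ofPred_eq, not_exists]
        exact Option.eq_none_iff_forall_ne_some
      rw [this]
      exact MeasurableSet.compl (MeasurableSet.iUnion hsome)
  · rintro _ ⟨I, a, rfl⟩
    have : {x : ℝ≥0 → Option E | ∀ r ∈ I, x r = some (a r)} =
        ⋂ r ∈ I, (fun x : ℝ≥0 → Option E => x r) ⁻¹' {some (a r)} := by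
      ext x
      simp
    rw [this]
    exact Finset.measurableSet_biInter I fun r _ =>
      measurable_pi_apply r (MeasurableSet.of_discrete (s := {some (a r)}))

theorem HasTransition.identDistrib [Countable E] [MeasurableSpace (Option E)]
    [DiscreteMeasurableSpace (Option E)] [IsProbabilityMeasure μ] [IsProbabilityMeasure P]
    {x₀ : E} (hX : HasTransition μ X p) (hX' : HasTransition P X' p)
    (hm : ∀ t (S : Set (Option E)), MeasurableSet (X t ⁻¹' S))
    (hm' : ∀ t (S : Set (Option E)), MeasurableSet (X' t ⁻¹' S))
    (h0 : ∀ᵐ ω ∂μ, X 0 ω = some x₀) (h0' : ∀ᵐ ω ∂P, X' 0 ω = some x₀) :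
    IdentDistrib (fun ω t => X t ω) (fun ω t => X' t ω) μ P := by
  have hmeas : Measurable fun ω t => X t ω := measurable_pi_iff.2 fun t S _ => hm t S
  have hmeas' : Measurable fun ω t => X' t ω := measurable_pi_iff.2 fun t S _ => hm' t S
  have : Nonempty E := ⟨x₀⟩
  have := Measure.isProbabilityMeasure_map (μ := μ) hmeas.aemeasurable
  have := Measure.isProbabilityMeasure_map (μ := P) hmeas'.aemeasurable
  refine ⟨hmeas.aemeasurable, hmeas'.aemeasurable, ?_⟩
  refine ext_of_generate_finite _ generateFrom_stateCylinders isPiSystem_stateCylinders ?_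
    (by simp)
  rintro S hS
  have hSm : MeasurableSet S := by
    rw [generateFrom_stateCylinders]
    exact MeasurableSpace.measurableSet_generateFrom hS
  obtain ⟨I, a, rfl⟩ := hS
  rw [Measure.map_apply hmeas hSm, Measure.map_apply hmeas' hSm]
  exact (measureReal_eq_measureReal_iff (measure_ne_top _ _) (measure_ne_top _ _)).1
    (hX.cylinder_eq hX' h0 h0' I a)

/-- A jump from `a` to `b` before time `N` shows on every sufficiently fine grid. On the grid of
mesh `δ` this has probability at most `N * p δ a b / δ`, which tends to `0`. -/
theorem HasTransition.ae_no_jump [IsProbabilityMeasure μ] (hX : HasTransition μ X p)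
    (hp : IsTransitionFunction p)
    (hpath : ∀ᵐ ω ∂μ, IsJumpPath fun t => X t ω) {a b : E}
    (hab : Tendsto (fun h : ℝ≥0 => p h a b / (h : ℝ)) (𝓝[>] 0) (𝓝 0)) :
    ∀ᵐ ω ∂μ, ∀ u, 0 < u → (∀ᶠ v in 𝓝[<] u, X v ω = some a) → X u ω ≠ some b := by
  set δ : ℕ → ℝ≥0 := fun n => 1 / ((n + 1 : ℕ) : ℝ≥0) with hδ
  set A : ℕ → ℕ → Set Ω := fun N n => ⋃ k ∈ Finset.range (N * (n + 1)),
    {ω | X (k * δ n) ω = some a ∧ X (k * δ n + δ n) ω = some b} with hA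
  have hAle : ∀ N n, μ.real (A N n) ≤ N * (p (δ n) a b / (δ n : ℝ)) := by
    intro N n
    have h1 : μ.real (A N n) ≤ ∑ k ∈ Finset.range (N * (n + 1)), p (δ n) a b := by
      refine (measureReal_biUnion_finset_le _ _).trans (Finset.sum_le_sum fun k _ => ?_)
      rw [hX.apply_univ]
      exact mul_le_of_le_one_left (hp.nonneg _ _ _) measureReal_le_one
    refine h1.trans (le_of_eq ?_)
    rw [Finset.sum_const, Finset.card_range, nsmul_eq_mul, hδ]
    push_cast
    field_simp
  have hnull : ∀ N m, μ (⋂ n ≥ m, A N n) = 0 := by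
    intro N m
    have h1 : Tendsto (fun n => (N : ℝ) * (p (δ n) a b / (δ n : ℝ))) atTop (𝓝 0) := by
      have h := (hab.comp (tendsto_div_succ one_pos)).const_mul (N : ℝ)
      rw [mul_zero] at h
      exact h
    have h2 : μ.real (⋂ n ≥ m, A N n) ≤ 0 := by
      refine ge_of_tendsto h1 ?_
      filter_upwards [eventually_ge_atTop m] with n hn
      exact (measureReal_mono (Set.biInter_subset_of_mem hn) (measure_ne_top _ _)).trans (hAle N n)
    exact (measureReal_eq_zero_iff).1 (le_antisymm h2 measureReal_nonneg)
  have hnull' : ∀ᵐ ω ∂μ, ∀ N m, ω ∉ ⋂ n ≥ m, A N n :=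
    ae_all_iff.2 fun N => ae_all_iff.2 fun m => measure_eq_zero_iff_ae_notMem.1 (hnull N m)
  filter_upwards [hpath, hnull'] with ω hω hω' u hu hua hub
  obtain ⟨N, hN⟩ := exists_nat_ge u
  obtain ⟨m, hm⟩ := eventually_atTop.1 (hω.eventually_exists_grid hu hN hua hub)
  refine hω' N m (Set.mem_iInter₂.2 fun n hn => ?_)
  obtain ⟨k, hk, h⟩ := hm n hn
  exact Set.mem_biUnion (Finset.mem_coe.2 (Finset.mem_range.2 hk)) h

open Classical in
/-- If all jumps that the generator allows respect a preorder, then the process is monotone. -/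
theorem HasTransition.transition_eq_zero [IsProbabilityMeasure μ] [Countable E]
    (hX : HasTransition μ X p) (hp : IsTransitionFunction p) {gen : (E → ℝ) → E → ℝ}
    (hg : HasGenerator p gen) (hpath : ∀ᵐ ω ∂μ, IsJumpPath fun t => X t ω) {R : E → E → Prop}
    (hrefl : ∀ a, R a a) (htrans : ∀ a b c, R a b → R b c → R a c)
    (hgen : ∀ a b, ¬ R a b → gen (fun c => if c = b then 1 else 0) a = 0)
    {a b : E} (hab : ¬ R a b) (ha : ∃ s, 0 < μ.real {ω | X s ω = some a}) (t : ℝ≥0) :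
    p t a b = 0 := by
  have hno : ∀ᵐ ω ∂μ, ∀ c d, ¬ R c d →
      ∀ u, 0 < u → (∀ᶠ v in 𝓝[<] u, X v ω = some c) → X u ω ≠ some d := by
    rw [ae_all_iff]
    intro c
    rw [ae_all_iff]
    intro d
    by_cases hcd : R c d
    · exact Eventually.of_forall fun ω h => absurd hcd h
    · have hne : c ≠ d := by
        rintro rfl
        exact hcd (hrefl c)
      have hlim := hg.tendsto_div c d
      rw [hgen c d hcd, if_neg hne] at hlim
      simp only [sub_zero] at hlim
      filter_upwards [hX.ae_no_jump hp hpath hlim] with ω hω _ using hω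
  obtain ⟨s, hs⟩ := ha
  -- By monotonicity of the paths. This probability is also `P(X_s = a) * p t a b`, whose first
  -- factor is positive.
  have hzero : μ.real {ω | X s ω = some a ∧ X (s + t) ω = some b} = 0 := by
    rw [measureReal_eq_zero_iff]
    refine measure_eq_zero_iff_ae_notMem.2 ?_
    filter_upwards [hpath, hno] with ω hω hω' h
    refine hab (hω.rel_of_le hrefl htrans (fun u hu c d hc hd => ?_)
      (le_self_add : s ≤ s + t) h.1 h.2)
    by_contra hcd
    exact hω' c d hcd u hu hc hd
  rw [hX.apply_univ] at hzero
  exact (mul_eq_zero.1 hzero).resolve_left hs.ne'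

open Classical in
theorem HasTransition.exists_pos_of_gen_pos [IsProbabilityMeasure μ]
    (hX : HasTransition μ X p) {gen : (E → ℝ) → E → ℝ} (hg : HasGenerator p gen) {a b : E}
    (hab : a ≠ b) (hgen : 0 < gen (fun c => if c = b then 1 else 0) a)
    (ha : ∃ s, 0 < μ.real {ω | X s ω = some a}) : ∃ s, 0 < μ.real {ω | X s ω = some b} := by
  obtain ⟨s, hs⟩ := ha
  have hlim := hg.tendsto_div a b
  rw [if_neg hab] at hlim
  simp only [sub_zero] at hlim
  obtain ⟨h, hpos, hh⟩ := ((hlim.eventually_const_lt hgen).and self_mem_nhdsWithin).exists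
  have hph : 0 < p h a b := by
    have := mul_pos hpos (NNReal.coe_pos.2 hh)
    rwa [div_mul_cancel₀] at this
    exact (NNReal.coe_pos.2 hh).ne'
  refine ⟨s + h, (mul_pos hs hph).trans_le ?_⟩
  rw [← hX.apply_univ]
  exact measureReal_mono fun ω hω => hω.2

end Law

/-! ### Uniqueness in law of the growth process -/

section GrowthProcess

variable {Λ : Type*} [PartialOrder Λ]

open Classical in
theorem growthGenerator_indicator_of_not_subset (rate : Λ → ℝ) {A B : FinLowerSet Λ}
    (h : ¬ A.1 ⊆ B.1) : growthGenerator rate (fun C => if C = B then 1 else 0) A = 0 := by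
  refine finsum_eq_zero_of_forall_eq_zero fun α => ?_
  have h1 : grow A α ≠ B := by
    rintro rfl
    exact h (Set.subset_insert α.1 A.1)
  have h2 : A ≠ B := by
    rintro rfl
    exact h Set.Subset.rfl
  simp only [if_neg h1, if_neg h2, sub_self, mul_zero]

open Classical in
theorem growthGenerator_indicator_grow (rate : Λ → ℝ) (A : FinLowerSet Λ)
    (α : growthElements A) :
    growthGenerator rate (fun C => if C = grow A α then 1 else 0) A = rate α.1 := by
  have hne : A ≠ grow A α := fun h =>
    absurd (grow_injective A (a₁ := none) (a₂ := some α) h) (Option.some_ne_none α).symm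
  rw [growthGenerator, finsum_eq_single _ α]
  · simp only [if_true, if_neg hne, sub_zero, mul_one]
  · intro β hβ
    have h1 : grow A β ≠ grow A α := fun h =>
      hβ (Option.some.inj (grow_injective A (a₁ := some β) (a₂ := some α) h))
    simp only [if_neg h1, if_neg hne, sub_self, mul_zero]

/-- Remove a maximal element of `B`. -/
theorem exists_grow_eq {B : FinLowerSet Λ} (hB : B.1.Nonempty) :
    ∃ (A : FinLowerSet Λ) (α : growthElements A), grow A α = B ∧ A.1.ncard < B.1.ncard := by
  obtain ⟨α, hα⟩ := B.2.1.exists_maximal hB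
  have hlow : IsLowerSet (B.1 \ {α}) := by
    rintro x y hyx ⟨hx, hxα⟩
    refine ⟨B.2.2 hyx hx, ?_⟩
    rintro rfl
    exact hxα (le_antisymm (hα.2 hx hyx) hyx)
  have hmem : Minimal (fun x => x ∉ B.1 \ {α}) α := by
    refine ⟨fun h => h.2 rfl, fun y hy hyα => ?_⟩
    by_contra hne
    exact hy ⟨B.2.2 hyα hα.1, fun h => hne (le_of_eq (Eq.symm h))⟩
  refine ⟨⟨B.1 \ {α}, B.2.1.subset Set.sdiff_subset, hlow⟩, ⟨α, hmem⟩, ?_, ?_⟩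
  · refine FinLowerSet.ext ?_
    exact (Set.insert_sdiff_singleton).trans (Set.insert_eq_of_mem hα.1)
  · exact Set.ncard_sdiff_singleton_lt_of_mem hα.1 B.2.1

variable {Ω : Type*} [MeasurableSpace Ω] {μ : Measure Ω} [IsProbabilityMeasure μ]
  {X : ℝ≥0 → Ω → Option (FinLowerSet Λ)} {rate : Λ → ℝ}
  {p : ℝ≥0 → FinLowerSet Λ → FinLowerSet Λ → ℝ}

/-- Needed because the Markov property carries no information about `p` from states that are never
visited. Each state is built up from `∅` by steps of positive rate. -/
theorem HasTransition.exists_pos (hrate : ∀ α, 0 < rate α) (hX : HasTransition μ X p)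
    (hg : HasGenerator p (growthGenerator rate)) (h0 : ∀ᵐ ω ∂μ, X 0 ω = some emptyLower)
    (A : FinLowerSet Λ) : ∃ s, 0 < μ.real {ω | X s ω = some A} := by
  induction hn : A.1.ncard using Nat.strong_induction_on generalizing A with
  | _ n ih =>
    rcases A.1.eq_empty_or_nonempty with hA | hA
    · obtain rfl : A = emptyLower := FinLowerSet.ext hA
      refine ⟨0, ?_⟩
      have e : {ω | X 0 ω = some emptyLower} =ᵐ[μ] Set.univ := by
        filter_upwards [h0] with ω hω
        exact eq_true hω
      rw [measureReal_congr e, probReal_univ]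
      exact one_pos
    · obtain ⟨B, α, rfl, hlt⟩ := exists_grow_eq hA
      refine hX.exists_pos_of_gen_pos hg ?_ ?_ (ih _ (hn ▸ hlt) B rfl)
      · exact fun h => hlt.ne (congrArg (fun C : FinLowerSet Λ => C.1.ncard) h)
      · rw [growthGenerator_indicator_grow]
        exact hrate α.1

theorem HasTransition.eq_zero_of_not_subset [Countable Λ] (hrate : ∀ α, 0 < rate α)
    (hX : HasTransition μ X p) (hp : IsTransitionFunction p)
    (hg : HasGenerator p (growthGenerator rate)) (h0 : ∀ᵐ ω ∂μ, X 0 ω = some emptyLower)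
    (hpath : ∀ᵐ ω ∂μ, IsJumpPath fun t => X t ω) {A B : FinLowerSet Λ} (hAB : ¬ A.1 ⊆ B.1)
    (t : ℝ≥0) : p t A B = 0 := by
  have := FinLowerSet.countable (Λ := Λ)
  exact hX.transition_eq_zero (R := fun A B => A.1 ⊆ B.1) hp hg hpath (fun _ => Set.Subset.rfl)
    (fun _ _ _ => Set.Subset.trans)
    (fun _ _ h => growthGenerator_indicator_of_not_subset rate h) hAB
    (hX.exists_pos hrate hg h0 A) t

/-- Only the finitely many lower sets contained in `B` lead to `B`, so the two transition functions,
a priori different, coincide. -/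
theorem IsMarkovJumpProcess.identDistrib [Countable Λ] (hrate : ∀ α, 0 < rate α)
    {Ω' : Type*} [MeasurableSpace Ω'] {P : Measure Ω'} [IsProbabilityMeasure P]
    {X' : ℝ≥0 → Ω' → Option (FinLowerSet Λ)}
    (hX : IsMarkovJumpProcess μ X emptyLower (growthGenerator rate))
    (hX' : IsMarkovJumpProcess P X' emptyLower (growthGenerator rate)) :
    IdentDistrib (fun ω t => X t ω) (fun ω t => X' t ω) μ P := by
  have := FinLowerSet.countable (Λ := Λ)
  obtain ⟨p, hp, hg, hm⟩ := hX.markov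
  obtain ⟨p', hp', hg', hm'⟩ := hX'.markov
  have hT : HasTransition μ X p := hm
  have hT' : HasTransition P X' p' := hm'
  have hpp : p' = p := by
    funext t A B
    have hfin : {C : FinLowerSet Λ | C.1 ⊆ B.1}.Finite := by
      refine Set.Finite.of_finite_image (f := fun C => C.1) (B.2.1.finite_subsets.subset ?_)
        fun C _ D _ h => FinLowerSet.ext h
      rintro _ ⟨C, hC, rfl⟩
      exact hC
    refine transition_unique hp' hp hg' hg (S := hfin.toFinset) (fun t C hC => ?_)
      (fun t C hC => ?_) t A
    · exact hT'.eq_zero_of_not_subset hrate hp' hg' hX'.initial hX'.jumpPath (by simpa using hC) t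
    · exact hT.eq_zero_of_not_subset hrate hp hg hX.initial hX.jumpPath (by simpa using hC) t
  subst hpp
  exact hT.identDistrib hT' hX.measurable hX'.measurable hX.initial hX'.initial

end GrowthProcess

/-! ### Passage times -/

section PassageTimes

variable {Λ : Type*} [PartialOrder Λ]

open Classical in
/-- The passage time computed along a countable dense set of times. -/
def densePassageTime (x : ℝ≥0 → Option (FinLowerSet Λ)) (A : FinLowerSet Λ) : EReal :=
  ⨅ n : ℕ, if ∃ B, x (TopologicalSpace.denseSeq ℝ≥0 n) = some B ∧ A.1 ⊆ B.1
    then ((TopologicalSpace.denseSeq ℝ≥0 n : ℝ) : EReal) else ⊤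

theorem measurable_densePassageTime :
    Measurable fun (x : ℝ≥0 → Option (FinLowerSet Λ)) A => densePassageTime x A := by
  refine measurable_pi_iff.2 fun A => Measurable.iInf fun n => ?_
  refine Measurable.ite ?_ measurable_const measurable_const
  have h : Measurable fun x : ℝ≥0 → Option (FinLowerSet Λ) =>
      x (TopologicalSpace.denseSeq ℝ≥0 n) :=
    measurable_pi_apply _
  exact h (MeasurableSet.of_discrete (s := {o | ∃ B : FinLowerSet Λ, o = some B ∧ A.1 ⊆ B.1}))

/-- An infimum over all times is not evidently measurable for the product σ-algebra. By
right-continuity a state containing `A` persists for a while, so dense times approach the infimum.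
-/
theorem IsJumpPath.passageTime_eq {x : ℝ≥0 → Option (FinLowerSet Λ)} (hx : IsJumpPath x)
    (A : FinLowerSet Λ) : passageTime x A = densePassageTime x A := by
  refine le_antisymm (le_iInf fun n => ?_) (le_sInf ?_)
  · split_ifs with h
    · exact sInf_le ⟨_, rfl, h⟩
    · exact le_top
  · rintro _ ⟨t, rfl, B, hB, hAB⟩
    by_contra! hlt
    obtain ⟨y, hty, hy⟩ := EReal.lt_iff_exists_real_btwn.1 hlt
    have hty : (t : ℝ) < y := EReal.coe_lt_coe_iff.1 hty
    lift y to ℝ≥0 using t.coe_nonneg.trans hty.le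
    have hty : t < y := NNReal.coe_lt_coe.1 hty
    obtain ⟨r, hr, hrB⟩ := mem_nhdsGT_iff_exists_Ioo_subset.1 (hx.right_cont t B hB)
    obtain ⟨n, hn⟩ := (TopologicalSpace.denseRange_denseSeq ℝ≥0).exists_mem_open
      (isOpen_Ioo (a := t) (b := min r y)) (Set.nonempty_Ioo.2 (lt_min hr hty))
    have h1 : densePassageTime x A ≤ ((TopologicalSpace.denseSeq ℝ≥0 n : ℝ) : EReal) := by
      refine (iInf_le _ n).trans (le_of_eq (if_pos ⟨B, ?_, hAB⟩))
      exact hrB ⟨hn.1, hn.2.trans_le (min_le_left _ _)⟩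
    have h2 : ((TopologicalSpace.denseSeq ℝ≥0 n : ℝ) : EReal) < ((y : ℝ) : EReal) :=
      EReal.coe_lt_coe_iff.2 (NNReal.coe_lt_coe.2 (hn.2.trans_le (min_le_right _ _)))
    exact absurd (h1.trans_lt (h2.trans hy)) (lt_irrefl _)

/-- Finiteness at all times matters: a passage at or after explosion would not be seen by
`passageTime`. -/
theorem passageTime_lppState [WellFoundedLT Λ] (hΛ : IsLocallyFinitePoset Λ) {g : Λ → ℝ}
    (hg : ∀ α, 0 ≤ g α) (hfin : ∀ t, (lppSet g t).Finite) (A : FinLowerSet Λ) :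
    passageTime (lppState g) A = ((passageValue g A : ℝ) : EReal) := by
  have key : ∀ t : ℝ≥0, (∃ B, lppState g t = some B ∧ A.1 ⊆ B.1) ↔ passageValue g A ≤ t := by
    intro t
    rw [passageValue_le_iff hΛ hg, ← lppSet_eq_grownSet hΛ hg]
    constructor
    · rintro ⟨B, hB, hAB⟩
      rwa [lppState_eq_some.1 hB]
    · exact fun h => ⟨⟨lppSet g t, hfin t, isLowerSet_lppSet g t⟩, lppState_eq_some.2 rfl, h⟩
  refine le_antisymm (sInf_le ?_) (le_sInf ?_)
  · exact ⟨⟨passageValue g A, passageValue_nonneg hg A⟩, rfl, (key _).2 le_rfl⟩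
  · rintro _ ⟨t, rfl, h⟩
    exact EReal.coe_le_coe_iff.2 ((key t).1 h)

end PassageTimes

end CrystalGrowth

end

theorem proposition2p3 {Λ : Type*} [PartialOrder Λ]
    (hΛ : CrystalGrowth.IsLocallyFinitePoset Λ)
    (rate : Λ → ℝ) (hrate : ∀ α, 0 < rate α)
    {Ω : Type*} [MeasurableSpace Ω] (μ : Measure Ω) [IsProbabilityMeasure μ]
    (G : Λ → Ω → ℝ) (hGmeas : ∀ α, Measurable (G α))
    (hGlaw : ∀ α, μ.map (G α) = expMeasure (rate α))
    (hGindep : iIndepFun G μ) :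
    CrystalGrowth.IsMarkovJumpProcess μ
      (fun t ω => CrystalGrowth.lppState (fun α => G α ω) t)
      CrystalGrowth.emptyLower (CrystalGrowth.growthGenerator rate) ∧
    ∀ (Ω' : Type*) [MeasurableSpace Ω'] (P : Measure Ω') [IsProbabilityMeasure P]
      (X : ℝ≥0 → Ω' → Option (CrystalGrowth.FinLowerSet Λ)),
      CrystalGrowth.IsMarkovJumpProcess P X
        CrystalGrowth.emptyLower (CrystalGrowth.growthGenerator rate) →
      IdentDistrib (fun ω t => CrystalGrowth.lppState (fun α => G α ω) t)
        (fun ω t => X t ω) μ P ∧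
      ((∀ t, ∀ᵐ ω ∂P, X t ω ≠ none) →
        (∀ᵐ ω ∂μ, ∀ t, (CrystalGrowth.lppSet (fun α => G α ω) t).Finite) ∧
        IdentDistrib
          (fun ω (A : CrystalGrowth.FinLowerSet Λ) =>
            ((CrystalGrowth.passageValue (fun α => G α ω) A : ℝ) : EReal))
          (fun ω A => CrystalGrowth.passageTime (fun t => X t ω) A) μ P) := by
  have hc := hΛ.countable
  have hwf := hΛ.wellFoundedLT
  have hY := CrystalGrowth.isMarkovJumpProcess_lppState hΛ hrate hGmeas hGlaw hGindep
  have hpos := CrystalGrowth.ae_forall_pos hΛ hrate hGmeas hGlaw hGindep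
  refine ⟨hY, fun Ω' _ P _ X hX => ?_⟩
  have hid := hY.identDistrib hrate hX
  refine ⟨hid, fun hne => ?_⟩
  have hfin : ∀ᵐ ω ∂μ, ∀ t, (CrystalGrowth.lppSet (fun α => G α ω) t).Finite := by
    -- Integer times suffice since the sets `Y_t` increase, and this keeps the exceptional null sets
    -- countable in number.
    have h : ∀ᵐ ω ∂μ, ∀ n : ℕ, CrystalGrowth.lppState (fun α => G α ω) n ≠ none := by
      rw [ae_all_iff]
      intro n
      have hn := hid.comp (measurable_pi_apply (n : ℝ≥0))
      exact hn.symm.ae_snd (p := fun o => o ≠ none) MeasurableSet.of_discrete (hne n)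
    filter_upwards [h, hpos] with ω hω hω' t
    obtain ⟨n, hn⟩ := exists_nat_ge t
    have hle := CrystalGrowth.grownSet_mono (fun α => ENNReal.ofReal (G α ω)) hn
    rw [← CrystalGrowth.lppSet_eq_grownSet hΛ fun α => (hω' α).le,
      ← CrystalGrowth.lppSet_eq_grownSet hΛ fun α => (hω' α).le] at hle
    exact (CrystalGrowth.lppState_ne_none.1 (hω n)).subset hle
  refine ⟨hfin, ?_⟩
  -- Both families agree almost surely with the same measurable functional of their process.
  have hd := hid.comp CrystalGrowth.measurable_densePassageTime
  refine (IdentDistrib.of_ae_eq hd.aemeasurable_fst ?_).symm.trans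
    (hd.trans (IdentDistrib.of_ae_eq hd.aemeasurable_snd ?_))
  · filter_upwards [hfin, hpos, hY.jumpPath] with ω h1 h2 h3
    funext A
    exact (h3.passageTime_eq A).symm.trans
      (CrystalGrowth.passageTime_lppState hΛ (fun α => (h2 α).le) h1 A)
  · filter_upwards [hX.jumpPath] with ω hω
    funext A
    exact (hω.passageTime_eq A).symm
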